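/- Throughout, $\log$ is to base $2$ and $\mathbb{N}=\{1,2,\dots\}$. Let $P,Q$ be probability distributions on a Polish space $\mathcal{U}$ (with its Borel $\sigma$-algebra) with $P\ll Q$. Let $T_1,T_2,\dots$ be the successive points of a rate-one Poisson process on $[0,\infty)$, let $U_1,U_2,\dots$ be i.i.d. with law $Q$ and independent of $(T_i)_{i\ge 1}$, and let $$K=\operatorname*{arg\,min}_{i\ge 1}\frac{T_i}{\frac{dP}{dQ}(U_i)}$$ (with value $\infty$ for the ratio when $\frac{dP}{dQ}(U_i)=0$) be the index produced by the Poisson functional representation; the minimizer almost surely exists and is unique. For $\beta>1$ let $$D_\beta(P\|Q)=\frac{1}{\beta-1}\log \mathbb{E}_{X\sim Q}\Big[\Big(\frac{dP}{dQ}(X)\Big)^{\beta}\Big]\in[0,\infty]$$ be the Rényi divergence of order $\beta$, and for a binary code $\mathcal{C}:\mathbb{N}\to\{0,1\}^*$ with codeword lengths $\ell(\mathcal{C}(k))$ and $t>0$ let $$L(t)=\frac1t\log \mathbb{E}\big[2^{t\,\ell(\mathcal{C}(K))}\big]=\frac1t\log\sum_{k\ge 1}\mathbb{P}(K=k)\,2^{t\,\ell(\mathcal{C}(k))}\in[0,\infty]$$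 be its Campbell cost of order $t$. Then for all $0<\alpha<1$ and $\varepsilon>0$ there is a uniquely decodable binary code $\mathcal{C}$ for $K$ such that, with $t=\frac{1-\alpha}{\alpha}$, $$L(t)\le (1+\varepsilon)\,D_{\frac{1+\varepsilon(1-\alpha)}{\alpha}}(P\|Q)+c_1(\alpha,\varepsilon),$$ where $$c_1(\alpha,\varepsilon)=\begin{cases}(1+\varepsilon)\log e+1+\log\left(1+\frac1\varepsilon\right), & \frac12<\alpha<1 \text{ and } 0<\varepsilon<\frac{2\alpha-1}{1-\alpha},\\[4pt] \frac{\alpha}{1-\alpha}\log\Gamma\!\left(\frac{1+\varepsilon(1-\alpha)}{\alpha}\right)+4+3\varepsilon-\frac{2\alpha}{1-\alpha}+\log\left(1+\frac1\varepsilon\right), & \text{otherwise.}\end{cases}$$ (The first case is $(1+\varepsilon)t<1$, the second $(1+\varepsilon)t\ge 1$.) -/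

import Mathlib

open MeasureTheory ProbabilityTheory
open scoped ENNReal

noncomputable section

/-- Base-two logarithm of an extended nonnegative number, with `log2 0 = ⊥` and `log2 ⊤ = ⊤`. -/
def log2 (x : ℝ≥0∞) : EReal := ENNReal.log x / ((Real.log 2 : ℝ) : EReal)

/-- Rényi divergence of order `β`, in bits, of `P` with respect to `Q`
(meant for `P ≪ Q` and `0 < β`, `β ≠ 1`); it may be infinite. -/
def renyiDivergence {𝓤 : Type*} [MeasurableSpace 𝓤] (β : ℝ) (P Q : Measure 𝓤) : EReal :=
  ((1 / (β - 1) : ℝ) : EReal) * log2 (∫⁻ x, (P.rnDeriv Q x) ^ β ∂Q)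

/-- `T 1, T 2, …` are the successive points of a rate-one Poisson process on `[0, ∞)`: the partial
sums of independent exponential interarrival times of mean one. -/
def IsRateOnePoissonProcess {Ω : Type*} [MeasurableSpace Ω] (T : ℕ+ → Ω → ℝ)
    (μ : Measure Ω) : Prop :=
  ∃ τ : ℕ+ → Ω → ℝ, (∀ j, Measurable (τ j)) ∧ iIndepFun τ μ ∧
    (∀ j, μ.map (τ j) = expMeasure 1) ∧
    ∀ i ω, T i ω = ∑ j ∈ Finset.Icc 1 i, τ j ω

/-- `U 1, U 2, …` is an i.i.d. sequence with common law `Q`. -/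
def IsIIDSequence {Ω 𝓤 : Type*} [MeasurableSpace Ω] [MeasurableSpace 𝓤] (U : ℕ+ → Ω → 𝓤)
    (Q : Measure 𝓤) (μ : Measure Ω) : Prop :=
  (∀ i, Measurable (U i)) ∧ iIndepFun U μ ∧ ∀ i, μ.map (U i) = Q

/-- The setting of the Poisson functional representation: a rate-one Poisson process and an
independent i.i.d. sequence with law `Q`. -/
structure IsPoissonSetup {Ω 𝓤 : Type*} [MeasurableSpace Ω] [MeasurableSpace 𝓤]
    (T : ℕ+ → Ω → ℝ) (U : ℕ+ → Ω → 𝓤) (Q : Measure 𝓤) (μ : Measure Ω) : Prop where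
  poisson : IsRateOnePoissonProcess T μ
  iid : IsIIDSequence U Q μ
  indep : IndepFun (fun ω i => T i ω) (fun ω i => U i ω) μ

/-- The ratio `T i / (dP/dQ) (U i)`, which is `∞` where the density vanishes and `T i > 0`. -/
def pfrRatio {Ω 𝓤 : Type*} [MeasurableSpace 𝓤] (P Q : Measure 𝓤)
    (T : ℕ+ → Ω → ℝ) (U : ℕ+ → Ω → 𝓤) (ω : Ω) (i : ℕ+) : ℝ≥0∞ :=
  ENNReal.ofReal (T i ω) / P.rnDeriv Q (U i ω)

/-- `k` minimizes the ratio `T i / (dP/dQ) (U i)` over `i ≥ 1` at the sample point `ω`. -/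
def IsPFRMinimizer {Ω 𝓤 : Type*} [MeasurableSpace 𝓤] (P Q : Measure 𝓤)
    (T : ℕ+ → Ω → ℝ) (U : ℕ+ → Ω → 𝓤) (ω : Ω) (k : ℕ+) : Prop :=
  ∀ i, pfrRatio P Q T U ω k ≤ pfrRatio P Q T U ω i

open Classical in
/-- The index `K` produced by the Poisson functional representation: the `arg min` over `i ≥ 1` of
`T i / (dP/dQ) (U i)`. Almost surely there is exactly one minimizer; on the exceptional null set
the least minimizer is taken, or `1` if there is none. -/
def pfrIndex {Ω 𝓤 : Type*} [MeasurableSpace 𝓤] (P Q : Measure 𝓤)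
    (T : ℕ+ → Ω → ℝ) (U : ℕ+ → Ω → 𝓤) (ω : Ω) : ℕ+ :=
  if h : ∃ k, IsPFRMinimizer P Q T U ω k then PNat.find h else 1

/-- A binary code on the positive integers is uniquely decodable if it is injective and distinct
finite sequences of codewords have distinct concatenations. -/
def IsUniquelyDecodableCode (C : ℕ+ → List Bool) : Prop :=
  Function.Injective C ∧ InformationTheory.UniquelyDecodable (Set.range C)

/-- Campbell's average codeword length of order `t`,
`L(t) = (1 / t) log₂ ∑ₖ ℙ(K = k) 2 ^ (t ℓ(C(k)))`; it may be infinite. -/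
def campbellCost {Ω : Type*} [MeasurableSpace Ω] (μ : Measure Ω) (K : Ω → ℕ+)
    (C : ℕ+ → List Bool) (t : ℝ) : EReal :=
  ((1 / t : ℝ) : EReal) *
    log2 (∑' k : ℕ+, μ {ω | K ω = k} * (2 : ℝ≥0∞) ^ (t * ((C k).length : ℝ)))

open Classical in
/-- The additive constant `c₁(α, ε)`. -/
def c₁ (α ε : ℝ) : ℝ :=
  if 1 / 2 < α ∧ α < 1 ∧ 0 < ε ∧ ε < (2 * α - 1) / (1 - α) then
    (1 + ε) * Real.logb 2 (Real.exp 1) + 1 + Real.logb 2 (1 + 1 / ε)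
  else
    α / (1 - α) * Real.logb 2 (Real.Gamma ((1 + ε * (1 - α)) / α)) + 4 + 3 * ε
      - 2 * α / (1 - α) + Real.logb 2 (1 + 1 / ε)

end

/-! Write f = dP/dQ. The core is a bound on the law of K. Suppose the point of index k (counting
from zero) sits at time s with mark w, and put z = f / f(w). A point (t, v) does not beat it exactly
when s z(v) ≤ t, an event of Q-probability m(t, s). The k earlier points must all comply, which
contributes e^{-s} (∫_0^s m)^k / k! with ∫_0^s m = s A, A = E_Q (1 - z)⁺. That all later points
comply is a void event for a thinned Poisson process, of probability e^{-sB}, B = E_Q (z - 1)⁺.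
These two factors come from `lintegral_palm` and `iInf_survival_le_exp`; integrating over s and w
gives `measure_minimizerEvent_le`, with integrand A^k / (1 + B)^(k+1).

Since E_Q z = 1 / f(w), one has A + 1 / f(w) = 1 + B. The integrand is therefore f(w) times a
geometric law of mean 1 + c with c = f(w) A ≤ f(w): under w ~ P, the index is a mixture of geometric
variables. Moments of geometric variables then give E[K^r] ≤ const · E_P[(1 + f)^r] ≤ const ·
E_Q[f^(1+r)] (`tsum_rpow_mul_measure_minimizerEvent_le`,
`lintegral_mul_one_add_rpow_le_densityConst`). Only upper bounds on P(K = k) are needed throughout.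

For the code, the lengths ⌈(1 + ε) log k + log(1 + 1/ε)⌉ satisfy Kraft's inequality because ∑
k^{-(1+ε)} ≤ 1 + 1/ε (`exists_uniquelyDecodable_code`). Then 2^{tℓ(k)} is at most a constant times
k^r with r = (1 + ε)t, and 1 + r is the Rényi order of the theorem (`tsum_campbell_le`). The
minimizer exists by a Borel–Cantelli argument, and is unique because the points have continuous laws
(`ae_existsUnique_minimizer`). -/

instance isProbabilityMeasure_expMeasure_one : IsProbabilityMeasure (expMeasure 1) :=
  isProbabilityMeasure_expMeasure one_pos

/-! ### Splitting off the first term of an i.i.d. sequence -/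

/-- Prepend an element to a sequence. -/
def seqCons {E : Type*} (y : E) (σ : ℕ → E) : ℕ → E
  | 0 => y
  | n + 1 => σ n

lemma measurable_seqCons {E : Type*} [MeasurableSpace E] :
    Measurable (fun p : E × (ℕ → E) => seqCons p.1 p.2) := by
  refine measurable_pi_iff.2 fun n => ?_
  cases n with
  | zero => exact measurable_fst
  | succ n => exact (measurable_pi_apply n).comp measurable_snd

lemma map_seqCons_prod_infinitePi {E : Type*} [MeasurableSpace E] (ν : Measure E)
    [IsProbabilityMeasure ν] :
    (ν.prod (Measure.infinitePi fun _ : ℕ => ν)).map (fun p => seqCons p.1 p.2) =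
      Measure.infinitePi fun _ : ℕ => ν := by
  refine Measure.eq_infinitePi _ fun s t ht => ?_
  classical
  set s' : Finset ℕ := (s.erase 0).image Nat.pred
  have key : (fun p : E × (ℕ → E) => seqCons p.1 p.2) ⁻¹' (Set.pi s t) =
      (if 0 ∈ s then t 0 else Set.univ) ×ˢ (Set.pi s' fun n => t (n + 1)) := by
    ext ⟨y, σ⟩
    simp only [Set.mem_preimage, Set.mem_pi, Finset.mem_coe, Set.mem_prod]
    constructor
    · intro h
      refine ⟨?_, ?_⟩
      · split_ifs with h0
        · exact h 0 h0
        · trivial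
      · intro n hn
        obtain ⟨i, hi, rfl⟩ := Finset.mem_image.1 hn
        obtain ⟨hi0, his⟩ := Finset.mem_erase.1 hi
        obtain ⟨j, rfl⟩ := Nat.exists_eq_succ_of_ne_zero hi0
        exact h _ his
    · rintro ⟨h0, h1⟩ n hn
      cases n with
      | zero => simpa [hn, seqCons] using h0
      | succ n =>
        exact h1 n (Finset.mem_image.2 ⟨n + 1, Finset.mem_erase.2 ⟨by omega, hn⟩, rfl⟩)
  rw [Measure.map_apply measurable_seqCons
    (MeasurableSet.pi s.countable_toSet fun i _ => ht i), key, Measure.prod_prod,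
    Measure.infinitePi_pi _ (fun i _ => ht _)]
  have himg : ∏ i ∈ s', ν (t (i + 1)) = ∏ i ∈ s.erase 0, ν (t i) := by
    rw [Finset.prod_image]
    · refine Finset.prod_congr rfl fun i hi => ?_
      have := (Finset.mem_erase.1 hi).1
      rw [show i.pred + 1 = i by simp only [Nat.pred_eq_sub_one]; omega]
    · intro a ha b hb hab
      have := (Finset.mem_erase.1 ha).1
      have := (Finset.mem_erase.1 hb).1
      simp only [Nat.pred_eq_sub_one] at hab
      omega
  rw [himg]
  split_ifs with h0
  · rw [Finset.mul_prod_erase s (fun i => ν (t i)) h0]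
  · rw [Finset.erase_eq_of_notMem h0, measure_univ, one_mul]

/-- Renewal step: the tail of an i.i.d. sequence has the law of the whole sequence and is
independent of the first term. The inductions over Poisson points below rest on it. -/
lemma lintegral_infinitePi_seqCons {E : Type*} [MeasurableSpace E] (ν : Measure E)
    [IsProbabilityMeasure ν] {g : (ℕ → E) → ℝ≥0∞} (hg : Measurable g) :
    ∫⁻ τ, g τ ∂(Measure.infinitePi fun _ : ℕ => ν) =
      ∫⁻ y, ∫⁻ σ, g (seqCons y σ) ∂(Measure.infinitePi fun _ : ℕ => ν) ∂ν := by
  conv_lhs => rw [← map_seqCons_prod_infinitePi ν]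
  rw [lintegral_map hg measurable_seqCons,
    lintegral_prod (fun p : E × (ℕ → E) => g (seqCons p.1 p.2))
      (hg.comp measurable_seqCons).aemeasurable]

/-! ### Survival of all points of a Poisson process under thinning -/

/-- The partial sums `τ 0 + ⋯ + τ i`. -/
noncomputable def partialSum (τ : ℕ → ℝ) (i : ℕ) : ℝ := ∑ j ∈ Finset.range (i + 1), τ j

lemma measurable_partialSum (i : ℕ) : Measurable fun τ => partialSum τ i :=
  Finset.measurable_sum _ fun j _ => measurable_pi_apply j

lemma partialSum_seqCons_zero (y : ℝ) (σ : ℕ → ℝ) : partialSum (seqCons y σ) 0 = y := by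
  simp [partialSum, seqCons]

lemma partialSum_seqCons_succ (y : ℝ) (σ : ℕ → ℝ) (i : ℕ) :
    partialSum (seqCons y σ) (i + 1) = y + partialSum σ i := by
  rw [partialSum, Finset.sum_range_succ', add_comm]
  rfl

/-- The law of the interarrival times of a rate-one Poisson process. -/
noncomputable abbrev expSeq : Measure (ℕ → ℝ) := Measure.infinitePi fun _ : ℕ => expMeasure 1

lemma lintegral_expMeasure_add (x : ℝ) {g : ℝ → ℝ≥0∞} (hg : Measurable g) :
    ∫⁻ y, g (x + y) ∂(expMeasure 1) =
      ∫⁻ y in Set.Ioi x, ENNReal.ofReal (Real.exp (-(y - x))) * g y := by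
  have h1 : expMeasure 1 = volume.withDensity (exponentialPDF 1) := rfl
  have hm : Measurable (exponentialPDF 1) := by
    exact (measurable_exponentialPDFReal 1).ennreal_ofReal
  have hg' : Measurable fun y => g (x + y) := hg.comp (measurable_const_add x)
  rw [h1, lintegral_withDensity_eq_lintegral_mul _ hm hg',
    ← lintegral_add_left_eq_self _ (-x), restrict_Ioi_eq_restrict_Ici,
    ← lintegral_indicator measurableSet_Ici]
  refine lintegral_congr fun y => ?_
  simp only [Pi.mul_apply, exponentialPDF_eq, Set.indicator, Set.mem_Ici]
  by_cases h : x ≤ y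
  · have : 0 ≤ -x + y := by linarith
    simp only [this, ↓reduceIte, one_mul, add_neg_cancel_left, h]
    congr 3
    ring
  · have : ¬ 0 ≤ -x + y := by linarith
    simp [h, this]

/-- The probability that all of the first `n` points of a Poisson process started at `x` survive
when a point at `t` survives with probability `F t`. -/
noncomputable def survival (F : ℝ → ℝ≥0∞) (n : ℕ) (x : ℝ) : ℝ≥0∞ :=
  ∫⁻ τ, ∏ i ∈ Finset.range n, F (x + partialSum τ i) ∂expSeq

lemma survival_zero (F : ℝ → ℝ≥0∞) (x : ℝ) : survival F 0 x = 1 := by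
  simp [survival]

lemma measurable_prod_partialSum {F : ℝ → ℝ≥0∞} (hF : Measurable F) (s : Finset ℕ) (x : ℝ) :
    Measurable fun τ : ℕ → ℝ => ∏ i ∈ s, F (x + partialSum τ i) :=
  Finset.measurable_prod _ fun i _ => hF.comp ((measurable_partialSum i).const_add x)

lemma measurable_survival {F : ℝ → ℝ≥0∞} (hF : Measurable F) (n : ℕ) :
    Measurable (survival F n) := by
  refine Measurable.lintegral_prod_right (f := fun (a : ℝ) (b : ℕ → ℝ) =>
    ∏ i ∈ Finset.range n, F (a + partialSum b i)) ?_
  exact Finset.measurable_prod _ fun i _ =>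
    hF.comp (measurable_fst.add ((measurable_partialSum i).comp measurable_snd))

/-- Backward equation: condition on the first point y after x; the process restarts at y with n
points left to survive. -/
lemma survival_succ {F : ℝ → ℝ≥0∞} (hF : Measurable F) (n : ℕ) (x : ℝ) :
    survival F (n + 1) x =
      ∫⁻ y in Set.Ioi x, ENNReal.ofReal (Real.exp (-(y - x))) * (F y * survival F n y) := by
  rw [← lintegral_expMeasure_add x (g := fun y => F y * survival F n y)
    (hF.mul (measurable_survival hF n)), survival,
    lintegral_infinitePi_seqCons _ (measurable_prod_partialSum hF _ x)]
  refine lintegral_congr fun y => ?_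
  simp only [Finset.prod_range_succ', partialSum_seqCons_zero, partialSum_seqCons_succ,
    ← add_assoc]
  rw [lintegral_mul_const _ (measurable_prod_partialSum hF _ _), mul_comm]
  rfl

lemma survival_antitone {F : ℝ → ℝ≥0∞} (h1 : ∀ y, F y ≤ 1) (x : ℝ) :
    Antitone fun n => survival F n x := by
  refine antitone_nat_of_succ_le fun n => lintegral_mono fun τ => ?_
  rw [Finset.prod_range_succ]
  exact mul_le_of_le_one_right' (h1 _)

/-- A monotone F is discontinuous at countably many points only, and the fundamental theorem of
calculus tolerates a countable exceptional set. Hence no continuity of survival probabilities is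
ever required. -/
lemma Monotone.hasDerivAt_integral_off_countable {F : ℝ → ℝ} (hF : Monotone F) (τ : ℝ) :
    ∃ s : Set ℝ, s.Countable ∧ ∀ y ∉ s, HasDerivAt (fun y => ∫ t in y..τ, F t) (-F y) y := by
  refine ⟨{y | ¬ ContinuousAt F y}, hF.countable_not_continuousAt, fun y hy => ?_⟩
  have hc : ContinuousAt F y := by simpa using hy
  exact intervalIntegral.integral_hasDerivAt_left hF.intervalIntegrable
    hF.measurable.stronglyMeasurable.stronglyMeasurableAtFilter hc

lemma Monotone.continuous_integral_left {F : ℝ → ℝ} (hF : Monotone F) (τ : ℝ) :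
    Continuous fun y => ∫ t in y..τ, F t := by
  have := (intervalIntegral.continuous_primitive (f := F)
    (fun a b => hF.intervalIntegrable (μ := volume)) τ).neg
  refine this.congr fun y => ?_
  simp [intervalIntegral.integral_symm y τ]

lemma Monotone.integral_mul_pow_integral {F : ℝ → ℝ} (hF : Monotone F) {x τ : ℝ} (k : ℕ) :
    ∫ y in x..τ, F y * (∫ t in y..τ, F t) ^ k = (∫ t in x..τ, F t) ^ (k + 1) / (k + 1) := by
  obtain ⟨s, hs, hd⟩ := hF.hasDerivAt_integral_off_countable τ
  have hcont := hF.continuous_integral_left τ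
  have hk : (k + 1 : ℝ) ≠ 0 := by positivity
  have := integral_eq_of_hasDerivAt_off_countable
    (fun y => -((∫ t in y..τ, F t) ^ (k + 1) / (k + 1)))
    (fun y => F y * (∫ t in y..τ, F t) ^ k) (a := x) (b := τ) hs
    (by fun_prop) (fun y hy => ?_) ?_
  · rw [this]; simp
  · have h := (((hd y hy.2).pow (k + 1)).div_const (k + 1 : ℝ)).neg
    refine h.congr_deriv ?_
    push_cast
    field_simp
  · exact hF.intervalIntegrable.mul_continuousOn (hcont.pow k).continuousOn

lemma lintegral_Ioc_ofReal_eq {F : ℝ → ℝ} (hF : Monotone F) (h0 : ∀ y, 0 ≤ F y) {x τ : ℝ}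
    (hx : x ≤ τ) :
    ∫⁻ t in Set.Ioc x τ, ENNReal.ofReal (F t) = ENNReal.ofReal (∫ t in x..τ, F t) := by
  rw [intervalIntegral.integral_of_le hx, ofReal_integral_eq_lintegral_ofReal
    ((intervalIntegrable_iff_integrableOn_Ioc_of_le hx).1 hF.intervalIntegrable)
    (ae_of_all _ h0)]

lemma lintegral_mul_pow_lintegral {m : ℝ → ℝ≥0∞} (hm : Monotone m) (h1 : ∀ y, m y ≠ ∞)
    {x τ : ℝ} (hx : x ≤ τ) (k : ℕ) :
    ∫⁻ y in Set.Ioc x τ, m y * (∫⁻ t in Set.Ioc y τ, m t) ^ k =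
      (∫⁻ t in Set.Ioc x τ, m t) ^ (k + 1) / (k + 1 : ℕ) := by
  set F : ℝ → ℝ := fun y => (m y).toReal
  have hF : Monotone F := fun a b hab => ENNReal.toReal_mono (h1 b) (hm hab)
  have h0 : ∀ y, 0 ≤ F y := fun y => ENNReal.toReal_nonneg
  have hmF : m = fun y => ENNReal.ofReal (F y) :=
    funext fun y => (ENNReal.ofReal_toReal (h1 y)).symm
  have hG : ∀ y ≤ τ, 0 ≤ ∫ t in y..τ, F t := fun y hy =>
    intervalIntegral.integral_nonneg hy fun t _ => h0 t
  rw [hmF, lintegral_Ioc_ofReal_eq hF h0 hx, ← ENNReal.ofReal_pow (hG x hx),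
    ← ENNReal.ofReal_natCast, ← ENNReal.ofReal_div_of_pos (by positivity)]
  push_cast
  rw [← hF.integral_mul_pow_integral, intervalIntegral.integral_of_le hx,
    ofReal_integral_eq_lintegral_ofReal]
  · refine setLIntegral_congr_fun measurableSet_Ioc fun y hy => ?_
    rw [lintegral_Ioc_ofReal_eq hF h0 hy.2, ENNReal.ofReal_mul (h0 y),
      ENNReal.ofReal_pow (hG y hy.2)]
  · exact (intervalIntegrable_iff_integrableOn_Ioc_of_le hx).1
      (hF.intervalIntegrable.mul_continuousOn ((hF.continuous_integral_left τ).pow k).continuousOn)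
  · refine (ae_restrict_iff' measurableSet_Ioc).2 (ae_of_all _ fun y hy => ?_)
    exact mul_nonneg (h0 y) (pow_nonneg (hG y hy.2) k)

/-- A supersolution estimate for the survival probability: if `H` solves the backward equation and
tends to one, then the survival probability of all points is at most `H`. -/
lemma survival_le_add {F H : ℝ → ℝ≥0∞} (hF : Measurable F) (hH : Measurable H)
    (hF1 : ∀ y, F y ≤ 1)
    (hstep : ∀ x, 0 ≤ x →
      ∫⁻ y in Set.Ioi x, ENNReal.ofReal (Real.exp (-(y - x))) * (F y * H y) ≤ H x)
    {δ : ℝ≥0∞} {r : ℝ} (hr : ∀ y, r ≤ y → 1 ≤ H y + δ) (n : ℕ) (x : ℝ) (hx : 0 ≤ x) :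
    survival F n x ≤ H x + δ + ENNReal.ofReal (Real.exp (r - x) * (1 / 2) ^ n) := by
  induction n generalizing x with
  | zero =>
    rw [survival_zero]
    rcases le_total r x with h | h
    · exact (hr x h).trans le_self_add
    -- Before `r` the last error term alone is at least 1, so nothing is needed of `H` there.
    · refine le_add_left ?_
      rw [← ENNReal.ofReal_one]
      refine ENNReal.ofReal_le_ofReal ?_
      simpa using Real.one_le_exp (sub_nonneg.2 h)
  | succ n ih =>
    have he : Measurable fun y : ℝ => ENNReal.ofReal (Real.exp (-(y - x))) := by fun_prop
    have hone : ∫⁻ y in Set.Ioi x, ENNReal.ofReal (Real.exp (-(y - x))) = 1 := by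
      simpa using (lintegral_expMeasure_add x (measurable_const (a := (1 : ℝ≥0∞)))).symm
    rw [survival_succ hF]
    calc ∫⁻ y in Set.Ioi x, ENNReal.ofReal (Real.exp (-(y - x))) * (F y * survival F n y)
        ≤ ∫⁻ y in Set.Ioi x, (ENNReal.ofReal (Real.exp (-(y - x))) * (F y * H y) +
            ENNReal.ofReal (Real.exp (-(y - x))) * δ +
            ENNReal.ofReal (Real.exp (-(y - x))) *
              ENNReal.ofReal (Real.exp (r - y) * (1 / 2) ^ n)) := by
          refine setLIntegral_mono (by fun_prop) fun y hy => ?_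
          rw [← mul_add, ← mul_add]
          gcongr
          refine (mul_le_mul_right (ih y (hx.trans (le_of_lt hy))) _).trans ?_
          rw [mul_add, mul_add]
          gcongr
          · exact mul_le_of_le_one_left' (hF1 y)
          · exact mul_le_of_le_one_left' (hF1 y)
      _ ≤ _ := by
          rw [lintegral_add_right _ (by fun_prop), lintegral_add_right _ (by fun_prop),
            lintegral_mul_const _ he, hone, one_mul]
          gcongr
          · exact hstep x hx
          -- The profile `exp (r - x)` is an eigenfunction of the exponential averaging with
          -- eigenvalue 1/2, so this error halves at each step.
          · have hval : ∫ y in Set.Ioi x,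
                Real.exp (r + x) * (1 / 2) ^ n * Real.exp ((-2) * y) =
                Real.exp (r - x) * (1 / 2) ^ (n + 1) := by
              rw [integral_const_mul, integral_exp_mul_Ioi (by norm_num)]
              have : Real.exp (r - x) = Real.exp (r + x) * Real.exp (-2 * x) := by
                rw [← Real.exp_add]
                ring_nf
              rw [this]
              ring
            rw [← hval, ofReal_integral_eq_lintegral_ofReal]
            · refine le_of_eq (lintegral_congr fun y => ?_)
              rw [← ENNReal.ofReal_mul (Real.exp_pos _).le, ← mul_assoc, ← Real.exp_add,
                mul_right_comm, ← Real.exp_add]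
              congr 3
              ring
            · exact (integrableOn_exp_mul_Ioi (by norm_num) x).const_mul _
            · exact ae_of_all _ fun y => by positivity

/-- In `survival_le_add`, `δ` is fixed first, which determines `r`; letting n tend to infinity
removes the geometric error, and then `δ` is arbitrary. -/
lemma iInf_survival_le {F H : ℝ → ℝ≥0∞} (hF : Measurable F) (hH : Measurable H)
    (hF1 : ∀ y, F y ≤ 1)
    (hstep : ∀ x, 0 ≤ x →
      ∫⁻ y in Set.Ioi x, ENNReal.ofReal (Real.exp (-(y - x))) * (F y * H y) ≤ H x)
    (hlim : Filter.Tendsto H Filter.atTop (nhds 1)) {x : ℝ} (hx : 0 ≤ x) :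
    ⨅ n, survival F n x ≤ H x := by
  refine ENNReal.le_of_forall_pos_le_add fun δ hδ _ => ?_
  have hev : ∀ᶠ y in Filter.atTop, 1 ≤ H y + δ := by
    have hlt : (1 : ℝ≥0∞) - δ < 1 :=
      ENNReal.sub_lt_self (by simp) (by simp) (by simpa using hδ.ne')
    filter_upwards [hlim.eventually_const_lt hlt] with y hy
    exact tsub_le_iff_right.1 hy.le
  obtain ⟨r, hr⟩ := Filter.eventually_atTop.1 hev
  have hle := survival_le_add hF hH hF1 hstep hr
  have ht : Filter.Tendsto
      (fun n : ℕ => H x + δ + ENNReal.ofReal (Real.exp (r - x) * (1 / 2) ^ n)) Filter.atTop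
      (nhds (H x + δ + ENNReal.ofReal (Real.exp (r - x) * 0))) := by
    refine Filter.Tendsto.const_add _ ((ENNReal.continuous_ofReal.tendsto _).comp ?_)
    exact (tendsto_pow_atTop_nhds_zero_of_lt_one (by norm_num) (by norm_num)).const_mul _
  simp only [mul_zero, ENNReal.ofReal_zero, add_zero] at ht
  exact ge_of_tendsto' ht fun n => (iInf_le _ n).trans (hle n x hx)

/-- The limiting survival probability is the void probability of the Poisson process thinned with
retention probability `1 - F`. -/
lemma iInf_survival_le_exp {F : ℝ → ℝ} (hF : Monotone F) (h0 : ∀ y, 0 ≤ F y) (h1 : ∀ y, F y ≤ 1)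
    (hint : IntegrableOn (fun y => 1 - F y) (Set.Ioi 0)) {x : ℝ} (hx : 0 ≤ x) :
    ⨅ n, survival (fun y => ENNReal.ofReal (F y)) n x ≤
      ENNReal.ofReal (Real.exp (-∫ y in Set.Ioi x, (1 - F y))) := by
  set I := ∫ y in Set.Ioi (0 : ℝ), (1 - F y)
  have hii : ∀ a b, IntervalIntegrable (fun y => 1 - F y) volume a b := fun a b =>
    intervalIntegrable_const.sub hF.intervalIntegrable
  -- The tail integral is rewritten as a constant minus a primitive, which makes it continuous on
  -- the whole line and differentiable off a countable set.
  set b : ℝ → ℝ := fun y => I - ∫ t in (0 : ℝ)..y, (1 - F t)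
  have hb : ∀ y, 0 ≤ y → ∫ t in Set.Ioi y, (1 - F t) = b y := fun y hy => by
    have := intervalIntegral.integral_interval_add_Ioi (hint) (hint.mono_set
      (Set.Ioi_subset_Ioi hy))
    simp only [b, I]
    linarith
  have hbc : Continuous b :=
    continuous_const.sub (intervalIntegral.continuous_primitive hii 0)
  have hbd : ∃ s : Set ℝ, s.Countable ∧ ∀ y ∉ s, HasDerivAt b (-(1 - F y)) y := by
    refine ⟨{y | ¬ ContinuousAt F y}, hF.countable_not_continuousAt, fun y hy => ?_⟩
    have hc : ContinuousAt F y := by simpa using hy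
    exact (intervalIntegral.integral_hasDerivAt_right (hii 0 y)
      ((measurable_const.sub hF.measurable).stronglyMeasurable.stronglyMeasurableAtFilter)
      (continuousAt_const.sub hc)).const_sub I
  have hlimb : Filter.Tendsto b Filter.atTop (nhds 0) := by
    have := intervalIntegral_tendsto_integral_Ioi (μ := volume) 0 hint Filter.tendsto_id
    have h2 := this.const_sub I
    simpa [b, I] using h2
  rw [hb x hx]
  refine iInf_survival_le (H := fun y => ENNReal.ofReal (Real.exp (-b y)))
    (hF.measurable.ennreal_ofReal) (by fun_prop) (fun y => by simpa using h1 y) ?_ ?_ hx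
  · intro x _
    obtain ⟨s, hs, hd⟩ := hbd
    -- Because b' = -(1 - F), the integrand is the derivative of -e^{-(y-x)} e^{-b(y)}. Its integral
    -- is e^{-b(x)} minus a positive boundary term at R.
    have hfin : ∀ R, x ≤ R → ∫⁻ y in Set.Ioc x R, ENNReal.ofReal (Real.exp (-(y - x))) *
        (ENNReal.ofReal (F y) * ENNReal.ofReal (Real.exp (-b y))) ≤
        ENNReal.ofReal (Real.exp (-b x)) := by
      intro R hR
      have hcont : Continuous fun y => Real.exp (-(y - x)) * Real.exp (-b y) := by fun_prop
      have hI : IntervalIntegrable (fun y => F y * (Real.exp (-(y - x)) * Real.exp (-b y)))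
          volume x R := hF.intervalIntegrable.mul_continuousOn hcont.continuousOn
      have := integral_eq_of_hasDerivAt_off_countable
        (fun y => -(Real.exp (-(y - x)) * Real.exp (-b y)))
        (fun y => F y * (Real.exp (-(y - x)) * Real.exp (-b y))) (a := x) (b := R) hs
        hcont.neg.continuousOn (fun y hy => ?_) hI
      · have hle : ∫ y in x..R, F y * (Real.exp (-(y - x)) * Real.exp (-b y)) ≤
            Real.exp (-b x) := by
          rw [this]
          have : 0 < Real.exp (-(R - x)) * Real.exp (-b R) := by positivity
          simp only [sub_self, neg_zero, Real.exp_zero, one_mul]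
          linarith
        refine le_trans (le_of_eq ?_) (ENNReal.ofReal_le_ofReal hle)
        rw [intervalIntegral.integral_of_le hR, ofReal_integral_eq_lintegral_ofReal
          ((intervalIntegrable_iff_integrableOn_Ioc_of_le hR).1 hI)
          (ae_of_all _ fun y => mul_nonneg (h0 y) (by positivity))]
        refine lintegral_congr fun y => ?_
        rw [ENNReal.ofReal_mul (h0 y), ENNReal.ofReal_mul (Real.exp_pos _).le]
        ring
      · have e1 : HasDerivAt (fun y => Real.exp (-(y - x))) (Real.exp (-(y - x)) * (-1)) y :=
          ((hasDerivAt_id y).sub_const x).neg.exp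
        have e2 : HasDerivAt (fun y => Real.exp (-b y)) (Real.exp (-b y) * -(-(1 - F y))) y :=
          (hd y hy.2).neg.exp
        refine (e1.mul e2).neg.congr_deriv ?_
        ring
    have hU : Set.Ioi x = ⋃ n : ℕ, Set.Ioc x (x + n) := by
      ext y
      simp only [Set.mem_Ioi, Set.mem_iUnion, Set.mem_Ioc]
      constructor
      · intro h
        obtain ⟨n, hn⟩ := exists_nat_ge (y - x)
        exact ⟨n, h, by linarith⟩
      · rintro ⟨n, h, _⟩
        exact h
    have hdir : Directed (· ⊆ ·) fun n : ℕ => Set.Ioc x (x + n) :=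
      Monotone.directed_le fun a b hab => Set.Ioc_subset_Ioc_right (by gcongr)
    rw [hU, setLIntegral_iUnion_of_directed _ hdir]
    exact iSup_le fun n => hfin _ (by simp)
  · have : Filter.Tendsto (fun y => Real.exp (-b y)) Filter.atTop (nhds (Real.exp (-0))) :=
      (Real.continuous_exp.tendsto _).comp hlimb.neg
    simpa [Function.comp_def] using (ENNReal.continuous_ofReal.tendsto _).comp this

/-! ### Palm formula for one point and the points around it -/

lemma measurable_lintegral_Ioc {m : ℝ → ℝ → ℝ≥0∞} (hm : Measurable (Function.uncurry m)) :
    Measurable fun p : ℝ × ℝ => ∫⁻ t in Set.Ioc p.1 p.2, m t p.2 := by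
  have : ∀ p : ℝ × ℝ, ∫⁻ t in Set.Ioc p.1 p.2, m t p.2 =
      ∫⁻ t, ({q : (ℝ × ℝ) × ℝ | q.1.1 < q.2 ∧ q.2 ≤ q.1.2}.indicator
        (fun q => m q.2 q.1.2)) (p, t) := by
    intro p
    rw [← lintegral_indicator measurableSet_Ioc]
    rfl
  simp_rw [this]
  refine Measurable.lintegral_prod_right' (Measurable.indicator ?_ ?_)
  · exact hm.comp (measurable_snd.prodMk (measurable_snd.comp measurable_fst))
  · exact (measurableSet_lt (measurable_fst.comp measurable_fst) measurable_snd).inter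
      (measurableSet_le measurable_snd (measurable_snd.comp measurable_fst))

lemma measurable_survival_diag {m : ℝ → ℝ → ℝ≥0∞} (hm : Measurable (Function.uncurry m)) (n : ℕ) :
    Measurable fun s => survival (fun t => m t s) n s := by
  refine Measurable.lintegral_prod_right (f := fun (a : ℝ) (b : ℕ → ℝ) =>
    ∏ i ∈ Finset.range n, m (a + partialSum b i) a) ?_
  refine Finset.measurable_prod _ fun i _ => ?_
  exact hm.comp ((measurable_fst.add ((measurable_partialSum i).comp measurable_snd)).prodMk
    measurable_fst)

lemma measurable_palm_integrand {m : ℝ → ℝ → ℝ≥0∞} (hm : Measurable (Function.uncurry m))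
    {φ : ℝ → ℝ → ℝ≥0∞} (hφ : Measurable (Function.uncurry φ)) (k n : ℕ) :
    Measurable fun p : ℝ × (ℕ → ℝ) =>
      (∏ i ∈ Finset.range k, m (p.1 + partialSum p.2 i) (p.1 + partialSum p.2 k)) *
        φ p.1 (p.1 + partialSum p.2 k) *
        ∏ i ∈ Finset.range n, m (p.1 + partialSum p.2 (k + 1 + i)) (p.1 + partialSum p.2 k) := by
  have h : ∀ i, Measurable fun p : ℝ × (ℕ → ℝ) => p.1 + partialSum p.2 i := fun i =>
    measurable_fst.add ((measurable_partialSum i).comp measurable_snd)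
  refine Measurable.mul (Measurable.mul ?_ ?_) ?_
  · exact Finset.measurable_prod _ fun i _ => hm.comp ((h i).prodMk (h k))
  · exact hφ.comp (measurable_fst.prodMk (h k))
  · exact Finset.measurable_prod _ fun i _ => hm.comp ((h _).prodMk (h k))

lemma lintegral_lintegral_Ioi_swap {x : ℝ} {g : ℝ → ℝ → ℝ≥0∞}
    (hg : Measurable (Function.uncurry g)) :
    ∫⁻ y in Set.Ioi x, ∫⁻ s in Set.Ioi y, g y s =
      ∫⁻ s in Set.Ioi x, ∫⁻ y in Set.Ioc x s, g y s := by
  have h1 : ∫⁻ y in Set.Ioi x, ∫⁻ s in Set.Ioi y, g y s =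
      ∫⁻ y, ∫⁻ s, {q : ℝ × ℝ | x < q.1 ∧ q.1 < q.2}.indicator (Function.uncurry g) (y, s) := by
    rw [← lintegral_indicator measurableSet_Ioi]
    refine lintegral_congr fun y => ?_
    by_cases hy : x < y
    · rw [Set.indicator_of_mem (by exact hy), ← lintegral_indicator measurableSet_Ioi]
      refine lintegral_congr fun s => ?_
      simp [Set.indicator, hy]
    · simp [Set.indicator, hy]
  have h2 : ∫⁻ s in Set.Ioi x, ∫⁻ y in Set.Ioc x s, g y s =
      ∫⁻ s, ∫⁻ y, {q : ℝ × ℝ | x < q.1 ∧ q.1 < q.2}.indicator (Function.uncurry g) (y, s) := by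
    rw [← lintegral_indicator measurableSet_Ioi]
    refine lintegral_congr fun s => ?_
    by_cases hs : x < s
    · rw [Set.indicator_of_mem (by exact hs), ← restrict_Ioo_eq_restrict_Ioc,
        ← lintegral_indicator measurableSet_Ioo]
      refine lintegral_congr fun y => ?_
      simp [Set.indicator]
    · rw [Set.indicator_of_notMem (by exact hs)]
      refine (lintegral_eq_zero_of_ae_eq_zero (ae_of_all _ fun y => ?_)).symm
      refine Set.indicator_of_notMem (fun h => hs ?_) _
      exact h.1.trans h.2
  rw [h1, h2]
  refine lintegral_lintegral_swap (Measurable.aemeasurable ?_)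
  exact hg.indicator ((measurableSet_lt measurable_const measurable_fst).inter
    (measurableSet_lt measurable_fst measurable_snd))

/-- Palm-type formula for a rate-one Poisson process: the joint effect of the `k` points before
the point `s = x + partialSum τ k` and of the `n` points following it. -/
lemma lintegral_palm {m : ℝ → ℝ → ℝ≥0∞} (hm : Measurable (Function.uncurry m))
    (hmono : ∀ s, Monotone fun t => m t s) (hfin : ∀ t s, m t s ≠ ∞) (k n : ℕ) (x : ℝ)
    {φ : ℝ → ℝ≥0∞} (hφ : Measurable φ) :
    ∫⁻ τ, (∏ i ∈ Finset.range k, m (x + partialSum τ i) (x + partialSum τ k)) *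
        φ (x + partialSum τ k) *
        ∏ i ∈ Finset.range n, m (x + partialSum τ (k + 1 + i)) (x + partialSum τ k) ∂expSeq =
      ∫⁻ s in Set.Ioi x, ENNReal.ofReal (Real.exp (-(s - x))) *
        ((∫⁻ t in Set.Ioc x s, m t s) ^ k / (k.factorial : ℝ≥0∞)) * φ s *
        survival (fun t => m t s) n s := by
  -- The starting time and `φ` both vary: after the first point y is split off, the process starts
  -- at y, and the factor `m y s` of that point is absorbed into `φ`.
  induction k generalizing x φ with
  | zero =>
    have hmeas := (measurable_palm_integrand hm (φ := fun _ => φ) (hφ.comp measurable_snd) 0 n).comp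
      (measurable_prodMk_left (x := x))
    have hφs : Measurable fun s => φ s * survival (fun t => m t s) n s :=
      hφ.mul (measurable_survival_diag hm n)
    refine (lintegral_infinitePi_seqCons _ hmeas).trans ?_
    simp only [Function.comp_def, Finset.range_zero, Finset.prod_empty, one_mul, partialSum_seqCons_zero, pow_zero,
      Nat.factorial_zero, Nat.cast_one, div_one, mul_one, mul_assoc, zero_add]
    rw [← lintegral_expMeasure_add x hφs]
    refine lintegral_congr fun y => ?_
    rw [lintegral_const_mul]
    · simp only [add_comm 1, partialSum_seqCons_succ, ← add_assoc]
      rfl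
    · refine Finset.measurable_prod _ fun i _ => ?_
      simp only [add_comm 1, partialSum_seqCons_succ]
      exact hm.comp ((((measurable_partialSum i).const_add y).const_add x).prodMk measurable_const)
  | succ k ih =>
    have hmeas := (measurable_palm_integrand hm (φ := fun _ => φ) (hφ.comp measurable_snd)
      (k + 1) n).comp (measurable_prodMk_left (x := x))
    have hψ : Measurable (Function.uncurry fun y s => m y s * φ s) :=
      hm.mul (hφ.comp measurable_snd)
    have hG := (measurable_palm_integrand hm hψ k n).lintegral_prod_right' (ν := expSeq)
    refine (lintegral_infinitePi_seqCons _ hmeas).trans ?_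
    have hrw : ∀ (y : ℝ) (σ : ℕ → ℝ),
        (∏ i ∈ Finset.range (k + 1), m (x + partialSum (seqCons y σ) i)
          (x + partialSum (seqCons y σ) (k + 1))) * φ (x + partialSum (seqCons y σ) (k + 1)) *
          ∏ i ∈ Finset.range n, m (x + partialSum (seqCons y σ) (k + 1 + 1 + i))
            (x + partialSum (seqCons y σ) (k + 1)) =
        (∏ i ∈ Finset.range k, m (x + y + partialSum σ i) (x + y + partialSum σ k)) *
          (m (x + y) (x + y + partialSum σ k) * φ (x + y + partialSum σ k)) *
          ∏ i ∈ Finset.range n, m (x + y + partialSum σ (k + 1 + i))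
            (x + y + partialSum σ k) := by
      intro y σ
      simp only [Finset.prod_range_succ', add_right_comm (k + 1) 1, partialSum_seqCons_succ,
        partialSum_seqCons_zero, ← add_assoc, mul_assoc]
    simp only [Function.comp_def, hrw]
    rw [lintegral_expMeasure_add x hG]
    have hIH : ∀ y, ∫⁻ σ, (∏ i ∈ Finset.range k, m (y + partialSum σ i) (y + partialSum σ k)) *
          (m y (y + partialSum σ k) * φ (y + partialSum σ k)) *
          ∏ i ∈ Finset.range n, m (y + partialSum σ (k + 1 + i)) (y + partialSum σ k) ∂expSeq =
        ∫⁻ s in Set.Ioi y, ENNReal.ofReal (Real.exp (-(s - y))) *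
        ((∫⁻ t in Set.Ioc y s, m t s) ^ k / (k.factorial : ℝ≥0∞)) * (m y s * φ s) *
        survival (fun t => m t s) n s := fun y =>
      ih y (hψ.comp (measurable_prodMk_left (x := y)))
    simp only [hIH]
    have hW := measurable_lintegral_Ioc hm
    have hS : Measurable fun p : ℝ × ℝ => survival (fun t => m t p.2) n p.2 :=
      (measurable_survival_diag hm n).comp measurable_snd
    let g : ℝ → ℝ → ℝ≥0∞ := fun y s => ENNReal.ofReal (Real.exp (-(s - y))) *
        ((∫⁻ t in Set.Ioc y s, m t s) ^ k / (k.factorial : ℝ≥0∞)) * (m y s * φ s) *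
        survival (fun t => m t s) n s
    have hg : Measurable (Function.uncurry g) := by
      refine ((Measurable.mul ?_ ((hW.pow_const k).div_const _)).mul hψ).mul hS
      exact (Real.measurable_exp.comp (measurable_snd.sub measurable_fst).neg).ennreal_ofReal
    have hg2 : Measurable (Function.uncurry fun y s =>
        ENNReal.ofReal (Real.exp (-(y - x))) * g y s) := by
      refine Measurable.mul ?_ hg
      exact (Real.measurable_exp.comp (measurable_fst.sub measurable_const).neg).ennreal_ofReal
    have hpull : ∀ y, ENNReal.ofReal (Real.exp (-(y - x))) * ∫⁻ s in Set.Ioi y, g y s =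
        ∫⁻ s in Set.Ioi y, ENNReal.ofReal (Real.exp (-(y - x))) * g y s := fun y =>
      (lintegral_const_mul _ (hg.comp (measurable_prodMk_left (x := y)))).symm
    change ∫⁻ y in Set.Ioi x, ENNReal.ofReal (Real.exp (-(y - x))) * ∫⁻ s in Set.Ioi y, g y s = _
    simp only [hpull]
    -- With s outermost, the two exponentials merge into one independent of y. What remains in y is
    -- `m y s` times a power of its own tail integral, which raises k to k + 1.
    rw [lintegral_lintegral_Ioi_swap hg2]
    refine setLIntegral_congr_fun measurableSet_Ioi fun s hs => ?_
    have hfact : ∀ y, ENNReal.ofReal (Real.exp (-(y - x))) * g y s =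
        (ENNReal.ofReal (Real.exp (-(s - x))) * (k.factorial : ℝ≥0∞)⁻¹ * φ s *
          survival (fun t => m t s) n s) * (m y s * (∫⁻ t in Set.Ioc y s, m t s) ^ k) := by
      intro y
      have he : ENNReal.ofReal (Real.exp (-(s - x))) =
          ENNReal.ofReal (Real.exp (-(y - x))) * ENNReal.ofReal (Real.exp (-(s - y))) := by
        rw [← ENNReal.ofReal_mul (Real.exp_pos _).le, ← Real.exp_add]
        ring_nf
      rw [he]
      simp only [g, div_eq_mul_inv]
      ring
    simp only [hfact]
    have hmW : Measurable fun y => m y s * (∫⁻ t in Set.Ioc y s, m t s) ^ k :=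
      (hm.comp (measurable_prodMk_right (y := s))).mul
        ((hW.comp (measurable_prodMk_right (y := s))).pow_const k)
    rw [lintegral_const_mul _ hmW, lintegral_mul_pow_lintegral (hmono s) (fun t => hfin t s)
      (le_of_lt hs), Nat.factorial_succ, Nat.cast_mul, div_eq_mul_inv, div_eq_mul_inv,
      ENNReal.mul_inv (by simp) (by simp)]
    ring

/-! ### Compatibility of marks with a minimizer at a given time -/

/-- Layer-cake formula by Tonelli: for fixed v, the admissible times form an interval from a to
g(v). -/
lemma lintegral_Ioi_measure_lt {𝓤 : Type*} [MeasurableSpace 𝓤] (Q : Measure 𝓤)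
    [IsProbabilityMeasure Q] {g : 𝓤 → ℝ≥0∞} (hg : Measurable g) {a : ℝ} (ha : 0 ≤ a) :
    ∫⁻ t in Set.Ioi a, Q {v | ENNReal.ofReal t < g v} = ∫⁻ v, (g v - ENNReal.ofReal a) ∂Q := by
  have hset : MeasurableSet {q : ℝ × 𝓤 | ENNReal.ofReal q.1 < g q.2} :=
    measurableSet_lt (ENNReal.measurable_ofReal.comp measurable_fst) (hg.comp measurable_snd)
  have h1 : ∀ t, Q {v | ENNReal.ofReal t < g v} =
      ∫⁻ v, {q : ℝ × 𝓤 | ENNReal.ofReal q.1 < g q.2}.indicator (fun _ => 1) (t, v) ∂Q := by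
    intro t
    rw [← lintegral_indicator_one (measurableSet_lt measurable_const hg)]
    rfl
  simp_rw [h1]
  rw [lintegral_lintegral_swap (f := fun t v =>
    {q : ℝ × 𝓤 | ENNReal.ofReal q.1 < g q.2}.indicator (fun _ => (1 : ℝ≥0∞)) (t, v))
    (by exact (measurable_const.indicator hset).aemeasurable)]
  refine lintegral_congr fun v => ?_
  have h2 : ∀ t, {q : ℝ × 𝓤 | ENNReal.ofReal q.1 < g q.2}.indicator (fun _ => (1 : ℝ≥0∞)) (t, v) =
      {t : ℝ | ENNReal.ofReal t < g v}.indicator 1 t := fun t => rfl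
  simp_rw [h2]
  rw [lintegral_indicator_one (measurableSet_lt ENNReal.measurable_ofReal measurable_const),
    Measure.restrict_apply (measurableSet_lt ENNReal.measurable_ofReal measurable_const)]
  by_cases hv : g v = ∞
  · simp [hv]
  · have : {t : ℝ | ENNReal.ofReal t < g v} ∩ Set.Ioi a = Set.Ioo a (g v).toReal := by
      ext t
      simp only [Set.mem_inter_iff, Set.mem_ofPred_eq, Set.mem_Ioi, Set.mem_Ioo]
      constructor
      · rintro ⟨h, h'⟩
        exact ⟨h', (ENNReal.ofReal_lt_iff_lt_toReal (ha.trans h'.le) hv).1 h⟩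
      · rintro ⟨h', h⟩
        exact ⟨(ENNReal.ofReal_lt_iff_lt_toReal (ha.trans h'.le) hv).2 h, h'⟩
    rw [this, Real.volume_Ioo, ENNReal.ofReal_sub _ ha, ENNReal.ofReal_toReal hv]

lemma lintegral_Ioc_measure_le_le {𝓤 : Type*} [MeasurableSpace 𝓤] (Q : Measure 𝓤)
    [IsProbabilityMeasure Q] {g : 𝓤 → ℝ≥0∞} (hg : Measurable g) {s : ℝ} :
    ∫⁻ t in Set.Ioc 0 s, Q {v | g v ≤ ENNReal.ofReal t} ≤
      ∫⁻ v, (ENNReal.ofReal s - g v) ∂Q := by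
  have hset : MeasurableSet {q : ℝ × 𝓤 | g q.2 ≤ ENNReal.ofReal q.1} :=
    measurableSet_le (hg.comp measurable_snd) (ENNReal.measurable_ofReal.comp measurable_fst)
  have h1 : ∀ t, Q {v | g v ≤ ENNReal.ofReal t} =
      ∫⁻ v, {q : ℝ × 𝓤 | g q.2 ≤ ENNReal.ofReal q.1}.indicator (fun _ => 1) (t, v) ∂Q := by
    intro t
    rw [← lintegral_indicator_one (measurableSet_le hg measurable_const)]
    rfl
  simp_rw [h1]
  rw [lintegral_lintegral_swap (f := fun t v =>
    {q : ℝ × 𝓤 | g q.2 ≤ ENNReal.ofReal q.1}.indicator (fun _ => (1 : ℝ≥0∞)) (t, v))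
    (by exact (measurable_const.indicator hset).aemeasurable)]
  refine lintegral_mono fun v => ?_
  have h2 : ∀ t, {q : ℝ × 𝓤 | g q.2 ≤ ENNReal.ofReal q.1}.indicator (fun _ => (1 : ℝ≥0∞)) (t, v) =
      {t : ℝ | g v ≤ ENNReal.ofReal t}.indicator 1 t := fun t => rfl
  simp_rw [h2]
  rw [lintegral_indicator_one (measurableSet_le measurable_const ENNReal.measurable_ofReal),
    Measure.restrict_apply (measurableSet_le measurable_const ENNReal.measurable_ofReal)]
  by_cases hv : g v = ∞
  · simp [hv]
  · have : {t : ℝ | g v ≤ ENNReal.ofReal t} ∩ Set.Ioc 0 s ⊆ Set.Icc (g v).toReal s := by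
      rintro t ⟨h, h0, h'⟩
      exact ⟨(ENNReal.le_ofReal_iff_toReal_le hv h0.le).1 h, h'⟩
    refine (measure_mono this).trans ?_
    rw [Real.volume_Icc, ENNReal.ofReal_sub _ ENNReal.toReal_nonneg, ENNReal.ofReal_toReal hv]

lemma lintegral_Ioi_exp_mul_pow (k : ℕ) {b : ℝ} (hb : 0 ≤ b) :
    ∫⁻ s in Set.Ioi (0 : ℝ), ENNReal.ofReal (Real.exp (-s)) *
      (ENNReal.ofReal s ^ k / (k.factorial : ℝ≥0∞)) * ENNReal.ofReal (Real.exp (-(s * b))) =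
      ((1 + ENNReal.ofReal b) ^ (k + 1))⁻¹ := by
  have hk : (0 : ℝ) < k.factorial := by exact_mod_cast k.factorial_pos
  have hpos : (0 : ℝ) < (k : ℝ) + 1 := by positivity
  have hb1 : 0 < 1 + b := by linarith
  have h1 : ∀ s ∈ Set.Ioi (0 : ℝ), ENNReal.ofReal (Real.exp (-s)) *
      (ENNReal.ofReal s ^ k / (k.factorial : ℝ≥0∞)) * ENNReal.ofReal (Real.exp (-(s * b))) =
      ENNReal.ofReal ((k.factorial : ℝ)⁻¹ *
        (s ^ ((k + 1 : ℝ) - 1) * Real.exp (-((1 + b) * s)))) := by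
    intro s hs
    have hs0 : (0 : ℝ) ≤ s := le_of_lt hs
    rw [← ENNReal.ofReal_pow hs0, ← ENNReal.ofReal_natCast, ← ENNReal.ofReal_div_of_pos hk,
      ← ENNReal.ofReal_mul (Real.exp_pos _).le, ← ENNReal.ofReal_mul (by positivity)]
    congr 1
    rw [add_sub_cancel_right, Real.rpow_natCast,
      show -((1 + b) * s) = -s + -(s * b) by ring, Real.exp_add]
    field_simp
  rw [setLIntegral_congr_fun measurableSet_Ioi h1]
  have hval : ∫ s in Set.Ioi (0 : ℝ), (k.factorial : ℝ)⁻¹ *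
      (s ^ ((k + 1 : ℝ) - 1) * Real.exp (-((1 + b) * s))) = ((1 + b) ^ (k + 1))⁻¹ := by
    rw [integral_const_mul, Real.integral_rpow_mul_exp_neg_mul_Ioi hpos hb1,
      Real.Gamma_nat_eq_factorial]
    have : (1 / (1 + b)) ^ ((k : ℝ) + 1) = ((1 + b) ^ (k + 1))⁻¹ := by
      rw [← Nat.cast_add_one, Real.rpow_natCast, one_div, inv_pow]
    rw [this]
    field_simp
  rw [← ofReal_integral_eq_lintegral_ofReal, hval, ENNReal.ofReal_inv_of_pos (by positivity),
    ENNReal.ofReal_pow hb1.le, ENNReal.ofReal_add zero_le_one hb, ENNReal.ofReal_one]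
  -- Integrability comes for free: a nonintegrable function has Bochner integral 0, whereas the
  -- computed value is positive.
  · by_contra h
    rw [integral_undef h] at hval
    have : 0 < ((1 + b) ^ (k + 1))⁻¹ := by positivity
    linarith
  · refine (ae_restrict_iff' measurableSet_Ioi).2 (ae_of_all _ fun s hs => ?_)
    have : (0 : ℝ) < s := hs
    positivity

/-- The probability that a mark `v` at time `t` is compatible with a minimizer at time `s`, where
`z v` is the ratio of the densities at `v` and at the minimizer. -/
noncomputable def markProb {𝓤 : Type*} [MeasurableSpace 𝓤] (Q : Measure 𝓤)
    (z : 𝓤 → ℝ≥0∞) (t s : ℝ) : ℝ≥0∞ :=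
  Q {v | ENNReal.ofReal s * z v ≤ ENNReal.ofReal t}

lemma monotone_markProb {𝓤 : Type*} [MeasurableSpace 𝓤] (Q : Measure 𝓤)
    (z : 𝓤 → ℝ≥0∞) (s : ℝ) : Monotone fun t => markProb Q z t s :=
  fun _ _ h => measure_mono fun _ hv => le_trans hv (ENNReal.ofReal_le_ofReal h)

lemma markProb_le_one {𝓤 : Type*} [MeasurableSpace 𝓤] (Q : Measure 𝓤)
    [IsProbabilityMeasure Q] (z : 𝓤 → ℝ≥0∞) (t s : ℝ) : markProb Q z t s ≤ 1 := prob_le_one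

/-- The expected number of incompatible points after s is ∫_s^∞ Q(s z > t) dt = s E_Q (z - 1)⁺, by
the layer-cake formula. The void probability is the exponential of its negative. -/
lemma iInf_survival_markProb_le {𝓤 : Type*} [MeasurableSpace 𝓤] (Q : Measure 𝓤)
    [IsProbabilityMeasure Q] {z : 𝓤 → ℝ≥0∞} (hz : Measurable z) (hfin : ∫⁻ v, z v ∂Q ≠ ∞)
    {s : ℝ} (hs : 0 < s) :
    ⨅ n, survival (fun t => markProb Q z t s) n s ≤
      ENNReal.ofReal (Real.exp (-(s * (∫⁻ v, (z v - 1) ∂Q).toReal))) := by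
  set F : ℝ → ℝ := fun t => (markProb Q z t s).toReal with hFdef
  have hne : ∀ t, markProb Q z t s ≠ ∞ := fun t =>
    ne_top_of_le_ne_top ENNReal.one_ne_top (markProb_le_one Q z t s)
  have hF : Monotone F := fun a b hab =>
    ENNReal.toReal_mono (hne b) (monotone_markProb Q z s hab)
  have h0 : ∀ y, 0 ≤ F y := fun y => ENNReal.toReal_nonneg
  have h1 : ∀ y, F y ≤ 1 := fun y => by
    simpa using ENNReal.toReal_mono ENNReal.one_ne_top (markProb_le_one Q z y s)
  have hsz : Measurable fun v => ENNReal.ofReal s * z v := hz.const_mul _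
  have hcompl : ∀ t, ENNReal.ofReal (1 - F t) = Q {v | ENNReal.ofReal t < ENNReal.ofReal s * z v} := by
    intro t
    have : {v | ENNReal.ofReal t < ENNReal.ofReal s * z v} =
        {v | ENNReal.ofReal s * z v ≤ ENNReal.ofReal t}ᶜ := by
      ext v; simp
    rw [this, prob_compl_eq_one_sub (measurableSet_le hsz measurable_const),
      ENNReal.ofReal_sub _ (h0 t), ENNReal.ofReal_one, ENNReal.ofReal_toReal (hne t)]
    rfl
  have hlin : ∀ a, 0 ≤ a → ∫⁻ t in Set.Ioi a, ENNReal.ofReal (1 - F t) =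
      ∫⁻ v, (ENNReal.ofReal s * z v - ENNReal.ofReal a) ∂Q := fun a ha => by
    simp_rw [hcompl]
    exact lintegral_Ioi_measure_lt Q hsz ha
  have hmeasF : Measurable fun y => 1 - F y := measurable_const.sub hF.measurable
  have hint : IntegrableOn (fun y => 1 - F y) (Set.Ioi 0) := by
    refine ⟨hmeasF.aestronglyMeasurable, ?_⟩
    rw [hasFiniteIntegral_iff_ofReal (ae_of_all _ fun y => by simpa using h1 y), hlin 0 le_rfl]
    simp only [ENNReal.ofReal_zero, tsub_zero]
    rw [lintegral_const_mul _ hz]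
    exact ENNReal.mul_lt_top ENNReal.ofReal_lt_top hfin.lt_top
  have hFm : (fun t => markProb Q z t s) = fun t => ENNReal.ofReal (F t) :=
    funext fun t => (ENNReal.ofReal_toReal (hne t)).symm
  rw [hFm]
  refine (iInf_survival_le_exp hF h0 h1 hint hs.le).trans (le_of_eq ?_)
  congr 3
  rw [integral_eq_lintegral_of_nonneg_ae (ae_of_all _ fun y => by simpa using h1 y)
    hmeasF.aestronglyMeasurable, hlin s hs.le]
  have : ∀ v, ENNReal.ofReal s * z v - ENNReal.ofReal s = ENNReal.ofReal s * (z v - 1) := by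
    intro v
    rw [ENNReal.mul_sub (fun _ _ => ENNReal.ofReal_ne_top), mul_one]
  simp_rw [this]
  rw [lintegral_const_mul _ (by fun_prop), ENNReal.toReal_mul,
    ENNReal.toReal_ofReal hs.le]

lemma lintegral_Ioc_markProb_le {𝓤 : Type*} [MeasurableSpace 𝓤] (Q : Measure 𝓤)
    [IsProbabilityMeasure Q] {z : 𝓤 → ℝ≥0∞} (hz : Measurable z) {s : ℝ} :
    ∫⁻ t in Set.Ioc 0 s, markProb Q z t s ≤ ENNReal.ofReal s * ∫⁻ v, (1 - z v) ∂Q := by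
  refine (lintegral_Ioc_measure_le_le Q (hz.const_mul (ENNReal.ofReal s))).trans (le_of_eq ?_)
  rw [← lintegral_const_mul _ (by fun_prop)]
  refine lintegral_congr fun v => ?_
  rw [ENNReal.mul_sub (fun _ _ => ENNReal.ofReal_ne_top), mul_one]

/-- Once the earlier points are bounded by (sA)^k / k! and the later ones by e^{-sB}, the integral
over s is a Gamma integral. -/
lemma lintegral_exp_markProb_le {𝓤 : Type*} [MeasurableSpace 𝓤] (Q : Measure 𝓤)
    [IsProbabilityMeasure Q] {z : 𝓤 → ℝ≥0∞} (hz : Measurable z) (hfin : ∫⁻ v, z v ∂Q ≠ ∞)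
    (k : ℕ) :
    ∫⁻ s in Set.Ioi (0 : ℝ), ENNReal.ofReal (Real.exp (-s)) *
        ((∫⁻ t in Set.Ioc 0 s, markProb Q z t s) ^ k / (k.factorial : ℝ≥0∞)) *
        ⨅ n, survival (fun t => markProb Q z t s) n s ≤
      (∫⁻ v, (1 - z v) ∂Q) ^ k * ((1 + ∫⁻ v, (z v - 1) ∂Q) ^ (k + 1))⁻¹ := by
  set A := ∫⁻ v, (1 - z v) ∂Q
  set B := ∫⁻ v, (z v - 1) ∂Q
  have hB : B ≠ ∞ := ne_top_of_le_ne_top hfin (lintegral_mono fun v => tsub_le_self)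
  have hexp := lintegral_Ioi_exp_mul_pow k (ENNReal.toReal_nonneg (a := B))
  rw [ENNReal.ofReal_toReal hB] at hexp
  rw [← hexp, ← lintegral_const_mul _ (by fun_prop)]
  refine setLIntegral_mono (by fun_prop) fun s hs => ?_
  calc _ ≤ ENNReal.ofReal (Real.exp (-s)) *
        ((ENNReal.ofReal s * A) ^ k / (k.factorial : ℝ≥0∞)) *
        ENNReal.ofReal (Real.exp (-(s * B.toReal))) := by
        gcongr
        · exact lintegral_Ioc_markProb_le Q hz
        · exact iInf_survival_markProb_le Q hz hfin hs
    _ = _ := by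
        rw [mul_pow, div_eq_mul_inv, div_eq_mul_inv]
        ring

/-! ### Geometric mixture bound for the minimizing index -/

/-- An infinite product measure of a set constraining the coordinates in `s` in terms of the
coordinate `k ∉ s`. -/
lemma infinitePi_setOf_forall_mem {ι 𝓤 : Type*} [MeasurableSpace 𝓤] (Q : Measure 𝓤)
    [IsProbabilityMeasure Q] {k : ι} {s : Finset ι} (hk : k ∉ s) {G : Set 𝓤}
    (hG : MeasurableSet G) {R : 𝓤 → ι → Set 𝓤}
    (hR : ∀ i, MeasurableSet {p : 𝓤 × 𝓤 | p.2 ∈ R p.1 i}) :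
    Measure.infinitePi (fun _ : ι => Q) {u | u k ∈ G ∧ ∀ i ∈ s, u i ∈ R (u k) i} =
      ∫⁻ w in G, ∏ i ∈ s, Q (R w i) ∂Q := by
  have hind : iIndepFun (fun (i : ι) (u : ι → 𝓤) => u i) (Measure.infinitePi fun _ : ι => Q) :=
    iIndepFun_infinitePi (X := fun _ => id) fun _ => measurable_id
  have hk0 : Measurable fun x : ({k} : Finset ι) → 𝓤 => x ⟨k, Finset.mem_singleton_self k⟩ :=
    measurable_pi_apply _
  have h1 := (hind.indepFun_finset {k} s (by simpa using hk) fun i => measurable_pi_apply i).comp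
    hk0 measurable_id
  have h2 : IndepFun (fun u : ι → 𝓤 => u k) (s.restrict : (ι → 𝓤) → (s → 𝓤))
    (Measure.infinitePi fun _ : ι => Q) := h1
  rw [indepFun_iff_map_prod_eq_prod_map_map (measurable_pi_apply k).aemeasurable
    (Finset.measurable_restrict s).aemeasurable, Measure.infinitePi_map_eval,
    Measure.infinitePi_map_restrict] at h2
  set S : Set (𝓤 × (s → 𝓤)) := {p | p.1 ∈ G ∧ ∀ i : s, p.2 i ∈ R p.1 i} with hS
  have hSm : MeasurableSet S := by
    have : S = Prod.fst ⁻¹' G ∩ ⋂ i : s, {p : 𝓤 × (s → 𝓤) | p.2 i ∈ R p.1 i} := by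
      ext p; simp [hS]
    rw [this]
    refine (measurable_fst hG).inter (MeasurableSet.iInter fun i => ?_)
    have hpm : Measurable fun p : 𝓤 × (s → 𝓤) => (p.1, p.2 i) :=
      measurable_fst.prodMk ((measurable_pi_apply i).comp measurable_snd)
    exact hpm (hR i)
  have hpre : {u : ι → 𝓤 | u k ∈ G ∧ ∀ i ∈ s, u i ∈ R (u k) i} =
      (fun u => (u k, s.restrict u)) ⁻¹' S := by
    ext u
    simp [hS]
  have hpairm : Measurable fun u : ι → 𝓤 => (u k, s.restrict u) :=
    (measurable_pi_apply k).prodMk (Finset.measurable_restrict s)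
  rw [hpre, ← Measure.map_apply hpairm hSm, h2, Measure.prod_apply hSm,
    ← lintegral_indicator hG]
  refine lintegral_congr fun w => ?_
  by_cases hw : w ∈ G
  · have : Prod.mk w ⁻¹' S = Set.pi Set.univ fun i : s => R w i := by
      ext v
      simp [hS, hw]
    rw [this, Measure.pi_pi, Set.indicator_of_mem hw, Finset.prod_coe_sort s fun i => Q (R w i)]
  · have : Prod.mk w ⁻¹' S = ∅ := by
      ext v
      simp [hS, hw]
    rw [this, measure_empty, Set.indicator_of_notMem hw]

/-- The event that the `k`-th point is a minimizer of `S i / f (u i)`, and has positive finite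
density. -/
def minimizerEvent {𝓤 : Type*} (f : 𝓤 → ℝ≥0∞) (k : ℕ) : Set ((ℕ → ℝ) × (ℕ → 𝓤)) :=
  {p | p.2 k ∈ {w | f w ≠ 0 ∧ f w ≠ ∞} ∧ ∀ i,
    ENNReal.ofReal (partialSum p.1 k) * ((f (p.2 k))⁻¹ * f (p.2 i)) ≤
      ENNReal.ofReal (partialSum p.1 i)}

lemma measurableSet_ne_zero_ne_top {𝓤 : Type*} [MeasurableSpace 𝓤] {f : 𝓤 → ℝ≥0∞}
    (hf : Measurable f) : MeasurableSet {w | f w ≠ 0 ∧ f w ≠ ∞} :=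
  ((measurableSet_eq_fun hf measurable_const).compl).inter
    (measurableSet_eq_fun hf measurable_const).compl

lemma measurable_markProb_joint {𝓤 : Type*} [MeasurableSpace 𝓤] (Q : Measure 𝓤)
    [IsProbabilityMeasure Q] {f : 𝓤 → ℝ≥0∞} (hf : Measurable f) :
    Measurable fun p : 𝓤 × ℝ × ℝ => markProb Q (fun v => (f p.1)⁻¹ * f v) p.2.1 p.2.2 := by
  have hset : MeasurableSet {q : (𝓤 × ℝ × ℝ) × 𝓤 |
      ENNReal.ofReal q.1.2.2 * ((f q.1.1)⁻¹ * f q.2) ≤ ENNReal.ofReal q.1.2.1} :=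
    measurableSet_le (by fun_prop) (by fun_prop)
  exact measurable_measure_prodMk_left hset

lemma measurable_prod_markProb {𝓤 : Type*} [MeasurableSpace 𝓤] (Q : Measure 𝓤)
    [IsProbabilityMeasure Q] {f : 𝓤 → ℝ≥0∞} (hf : Measurable f) (k : ℕ) (s : Finset ℕ) :
    Measurable fun p : (ℕ → ℝ) × 𝓤 => ∏ i ∈ s,
      markProb Q (fun v => (f p.2)⁻¹ * f v) (partialSum p.1 i) (partialSum p.1 k) := by
  refine Finset.measurable_prod _ fun i _ => ?_
  have harg : Measurable fun p : (ℕ → ℝ) × 𝓤 => (p.2, partialSum p.1 i, partialSum p.1 k) :=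
    measurable_snd.prodMk (((measurable_partialSum i).comp measurable_fst).prodMk
      ((measurable_partialSum k).comp measurable_fst))
  simpa only [Function.comp_def] using (measurable_markProb_joint Q hf).comp harg

lemma prod_range_erase_eq {M : Type*} [CommMonoid M] (k n : ℕ) (g : ℕ → M) :
    ∏ i ∈ (Finset.range (k + 1 + n)).erase k, g i =
      (∏ i ∈ Finset.range k, g i) * ∏ i ∈ Finset.range n, g (k + 1 + i) := by
  have : (Finset.range (k + 1 + n)).erase k =
      (Finset.range k).disjUnion ((Finset.range n).map (addLeftEmbedding (k + 1)))
        (Finset.disjoint_left.2 fun a ha hb => by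
          simp only [Finset.mem_map, addLeftEmbedding_apply, Finset.mem_range] at ha hb
          obtain ⟨b, _, rfl⟩ := hb
          omega) := by
    ext a
    simp only [Finset.mem_erase, Finset.mem_range, Finset.mem_disjUnion, Finset.mem_map,
      addLeftEmbedding_apply]
    constructor
    · rintro ⟨h1, h2⟩
      rcases lt_or_gt_of_ne h1 with h | h
      · exact Or.inl h
      · exact Or.inr ⟨a - (k + 1), by omega, by omega⟩
    · rintro (h | ⟨b, hb, rfl⟩) <;> omega
  rw [this, Finset.prod_disjUnion, Finset.prod_map]
  rfl

/-- Keeping only the constraints from the first k + 1 + n points enlarges the event and makes it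
finite-dimensional. For fixed times the marks are independent given the k-th one, which leaves a
product of `markProb` values; the Palm formula then integrates out the times. -/
lemma measure_minimizerEvent_le_lintegral {𝓤 : Type*} [MeasurableSpace 𝓤] (Q : Measure 𝓤)
    [IsProbabilityMeasure Q] {f : 𝓤 → ℝ≥0∞} (hf : Measurable f) (k n : ℕ) :
    (expSeq.prod (Measure.infinitePi fun _ : ℕ => Q)) (minimizerEvent f k) ≤
      ∫⁻ w in {w | f w ≠ 0 ∧ f w ≠ ∞}, (∫⁻ s in Set.Ioi (0 : ℝ), ENNReal.ofReal (Real.exp (-s)) *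
        ((∫⁻ t in Set.Ioc 0 s, markProb Q (fun v => (f w)⁻¹ * f v) t s) ^ k /
          (k.factorial : ℝ≥0∞)) *
        survival (fun t => markProb Q (fun v => (f w)⁻¹ * f v) t s) n s) ∂Q := by
  set G : Set 𝓤 := {w | f w ≠ 0 ∧ f w ≠ ∞}
  have hG : MeasurableSet G := measurableSet_ne_zero_ne_top hf
  set s := (Finset.range (k + 1 + n)).erase k
  set E : Set ((ℕ → ℝ) × (ℕ → 𝓤)) := {p | p.2 k ∈ G ∧ ∀ i ∈ s,
    ENNReal.ofReal (partialSum p.1 k) * ((f (p.2 k))⁻¹ * f (p.2 i)) ≤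
      ENNReal.ofReal (partialSum p.1 i)} with hE
  have hps : ∀ i, Measurable fun p : (ℕ → ℝ) × (ℕ → 𝓤) => partialSum p.1 i := fun i =>
    (measurable_partialSum i).comp measurable_fst
  have hcoord : ∀ i, Measurable fun p : (ℕ → ℝ) × (ℕ → 𝓤) => p.2 i := fun i =>
    (measurable_pi_apply i).comp measurable_snd
  have hEm : MeasurableSet E := by
    have : E = (fun p : (ℕ → ℝ) × (ℕ → 𝓤) => p.2 k) ⁻¹' G ∩ ⋂ i ∈ s,
        {p | ENNReal.ofReal (partialSum p.1 k) * ((f (p.2 k))⁻¹ * f (p.2 i)) ≤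
      ENNReal.ofReal (partialSum p.1 i)} := by
      ext p; simp [hE]
    rw [this]
    refine (hcoord k hG).inter (Finset.measurableSet_biInter _ fun i _ => ?_)
    exact measurableSet_le ((hps k).ennreal_ofReal.mul
      ((hf.comp (hcoord k)).inv.mul (hf.comp (hcoord i)))) (hps i).ennreal_ofReal
  have hsub : minimizerEvent f k ⊆ E := fun p hp => ⟨hp.1, fun i _ => hp.2 i⟩
  have hmark := measurable_markProb_joint Q hf
  refine (measure_mono hsub).trans (le_of_eq ?_)
  rw [Measure.prod_apply hEm]
  have hslice : ∀ τ : ℕ → ℝ, Measure.infinitePi (fun _ : ℕ => Q) (Prod.mk τ ⁻¹' E) =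
      ∫⁻ w in G, ∏ i ∈ s, markProb Q (fun v => (f w)⁻¹ * f v) (partialSum τ i)
        (partialSum τ k) ∂Q := by
    intro τ
    have hR : ∀ i, MeasurableSet {p : 𝓤 × 𝓤 | ENNReal.ofReal (partialSum τ k) *
        ((f p.1)⁻¹ * f p.2) ≤ ENNReal.ofReal (partialSum τ i)} := fun i =>
      measurableSet_le (by fun_prop) measurable_const
    exact infinitePi_setOf_forall_mem Q (Finset.notMem_erase k _) hG
      (R := fun w i => {v | ENNReal.ofReal (partialSum τ k) * ((f w)⁻¹ * f v) ≤
        ENNReal.ofReal (partialSum τ i)}) hR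
  simp_rw [hslice]
  rw [lintegral_lintegral_swap]
  · refine lintegral_congr fun w => ?_
    have hm : Measurable (Function.uncurry fun t s => markProb Q (fun v => (f w)⁻¹ * f v) t s) :=
      hmark.comp (measurable_prodMk_left (x := w))
    have := lintegral_palm hm (fun s => monotone_markProb Q _ s)
      (fun t s => ne_top_of_le_ne_top ENNReal.one_ne_top (markProb_le_one Q _ t s)) k n 0
      (φ := fun _ => 1) measurable_const
    simp only [zero_add, mul_one, sub_zero] at this
    rw [← this]
    refine lintegral_congr fun τ => ?_
    exact prod_range_erase_eq k n _
  · exact (measurable_prod_markProb Q hf k s).aemeasurable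

/-- The probability that the `k`-th point is the minimizer is at most a mixture of geometric
probabilities. -/
lemma measure_minimizerEvent_le {𝓤 : Type*} [MeasurableSpace 𝓤] (Q : Measure 𝓤)
    [IsProbabilityMeasure Q] {f : 𝓤 → ℝ≥0∞} (hf : Measurable f) (hfin : ∫⁻ v, f v ∂Q ≠ ∞) (k : ℕ) :
    (expSeq.prod (Measure.infinitePi fun _ : ℕ => Q)) (minimizerEvent f k) ≤
      ∫⁻ w in {w | f w ≠ 0 ∧ f w ≠ ∞}, (∫⁻ v, (1 - (f w)⁻¹ * f v) ∂Q) ^ k *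
        ((1 + ∫⁻ v, ((f w)⁻¹ * f v - 1) ∂Q) ^ (k + 1))⁻¹ ∂Q := by
  set G : Set 𝓤 := {w | f w ≠ 0 ∧ f w ≠ ∞} with hGdef
  have hG : MeasurableSet G := measurableSet_ne_zero_ne_top hf
  have hmark := measurable_markProb_joint Q hf
  set h : 𝓤 × ℝ → ℝ≥0∞ := fun p => ENNReal.ofReal (Real.exp (-p.2)) *
        ((∫⁻ t in Set.Ioc 0 p.2, markProb Q (fun v => (f p.1)⁻¹ * f v) t p.2) ^ k /
          (k.factorial : ℝ≥0∞)) with hh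
  set r : ℕ → 𝓤 × ℝ → ℝ≥0∞ := fun n p =>
    survival (fun t => markProb Q (fun v => (f p.1)⁻¹ * f v) t p.2) n p.2 with hr
  have hhm : Measurable h := by
    refine Measurable.mul (by fun_prop) (Measurable.div_const (Measurable.pow_const ?_ k) _)
    have : ∀ p : 𝓤 × ℝ, ∫⁻ t in Set.Ioc 0 p.2, markProb Q (fun v => (f p.1)⁻¹ * f v) t p.2 =
      ∫⁻ t, ({q : (𝓤 × ℝ) × ℝ | 0 < q.2 ∧ q.2 ≤ q.1.2}.indicator
        (fun q => markProb Q (fun v => (f q.1.1)⁻¹ * f v) q.2 q.1.2)) (p, t) := by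
      intro p
      rw [← lintegral_indicator measurableSet_Ioc]
      rfl
    simp_rw [this]
    refine Measurable.lintegral_prod_right' (Measurable.indicator ?_ ?_)
    · exact hmark.comp ((measurable_fst.comp measurable_fst).prodMk
        (measurable_snd.prodMk (measurable_snd.comp measurable_fst)))
    · exact (measurableSet_lt measurable_const measurable_snd).inter
        (measurableSet_le measurable_snd (measurable_snd.comp measurable_fst))
  have hrm : ∀ n, Measurable (r n) := by
    intro n
    refine Measurable.lintegral_prod_right (f := fun (a : 𝓤 × ℝ) (b : ℕ → ℝ) =>
      ∏ i ∈ Finset.range n, markProb Q (fun v => (f a.1)⁻¹ * f v) (a.2 + partialSum b i) a.2) ?_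
    refine Finset.measurable_prod _ fun i _ => ?_
    exact hmark.comp ((measurable_fst.comp measurable_fst).prodMk
      (((measurable_snd.comp measurable_fst).add ((measurable_partialSum i).comp
        measurable_snd)).prodMk (measurable_snd.comp measurable_fst)))
  have hhr : ∀ n, Measurable fun p => h p * r n p := fun n => hhm.mul (hrm n)
  have hanti : Antitone fun n p => h p * r n p := fun a b hab p =>
    mul_le_mul_right (survival_antitone (fun t => markProb_le_one Q _ t p.2) p.2 hab) _
  have hle_h : ∀ p, h p ≤ ENNReal.ofReal (Real.exp (-p.2)) *
      (ENNReal.ofReal p.2 ^ k / (k.factorial : ℝ≥0∞)) := by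
    intro p
    simp only [hh]
    gcongr
    calc _ ≤ ∫⁻ t in Set.Ioc 0 p.2, 1 := lintegral_mono fun t => markProb_le_one Q _ t p.2
      _ = _ := by simp
  -- Passing the infimum over n inside a decreasing family of integrals requires one finite member;
  -- n = 0 is dominated by a Gamma density of total mass 1.
  have hfin0 : ∫⁻ p, h p * r 0 p ∂((Q.restrict G).prod (volume.restrict (Set.Ioi (0 : ℝ)))) ≠ ∞ := by
    simp only [hr, survival_zero, mul_one]
    refine ne_top_of_le_ne_top ENNReal.one_ne_top ((lintegral_mono hle_h).trans ?_)
    rw [lintegral_prod _ (by fun_prop)]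
    have := lintegral_Ioi_exp_mul_pow k (le_refl (0 : ℝ))
    simp only [mul_zero, neg_zero, Real.exp_zero, ENNReal.ofReal_one, mul_one, ENNReal.ofReal_zero,
      add_zero, one_pow, inv_one] at this
    simp only [this, lintegral_const, one_mul, Measure.restrict_apply_univ]
    exact prob_le_one
  have hbound : (expSeq.prod (Measure.infinitePi fun _ : ℕ => Q)) (minimizerEvent f k) ≤
      ⨅ n, ∫⁻ p, h p * r n p ∂((Q.restrict G).prod (volume.restrict (Set.Ioi (0 : ℝ)))) := by
    refine le_iInf fun n => ?_
    rw [lintegral_prod _ (hhr n).aemeasurable]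
    exact measure_minimizerEvent_le_lintegral Q hf k n
  refine hbound.trans ?_
  rw [← lintegral_iInf hhr hanti hfin0,
    lintegral_prod _ (Measurable.iInf hhr).aemeasurable]
  refine lintegral_mono_ae ((ae_restrict_iff' hG).2 (ae_of_all _ fun w hw => ?_))
  have hz : Measurable fun v => (f w)⁻¹ * f v := hf.const_mul _
  have hzfin : ∫⁻ v, (f w)⁻¹ * f v ∂Q ≠ ∞ := by
    rw [lintegral_const_mul _ hf]
    exact ENNReal.mul_ne_top (ENNReal.inv_ne_top.2 hw.1) hfin
  refine le_trans (le_of_eq ?_) (lintegral_exp_markProb_le Q hz hzfin k)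
  refine lintegral_congr fun s => ?_
  rw [ENNReal.mul_iInf]
  intro htop
  exfalso
  refine ne_top_of_le_ne_top ?_ (hle_h (w, s)) htop
  exact ENNReal.mul_ne_top ENNReal.ofReal_ne_top
    (ENNReal.div_ne_top (ENNReal.pow_ne_top ENNReal.ofReal_ne_top)
      (by exact_mod_cast k.factorial_ne_zero))

/-! ### Moments of geometric variables -/

/-- Log-convexity of Γ at k + 1 = (1 - 1/r) k + (1/r)(k + r), combined with Γ(k + 1) = k Γ(k) and
raised to the power r. -/
lemma Real.natCast_rpow_le_Gamma_div {k : ℕ} (hk : 0 < k) {r : ℝ} (hr : 1 ≤ r) :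
    (k : ℝ) ^ r ≤ Real.Gamma (k + r) / Real.Gamma k := by
  have hk' : (0 : ℝ) < k := by exact_mod_cast hk
  have hG := Real.Gamma_pos_of_pos hk'
  have hG2 := Real.Gamma_pos_of_pos (show (0 : ℝ) < k + r by linarith)
  rw [le_div_iff₀ hG]
  rcases hr.eq_or_lt with rfl | hr1
  · rw [Real.rpow_one, Real.Gamma_add_one hk'.ne']
  have hr0 : 0 < r := by linarith
  have ha : 0 < 1 - 1 / r := by
    have : 1 / r < 1 := by rw [div_lt_one hr0]; exact hr1
    linarith
  have h := Real.Gamma_mul_add_mul_le_rpow_Gamma_mul_rpow_Gamma hk'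
    (show (0 : ℝ) < k + r by linarith) ha (one_div_pos.2 hr0) (by ring)
  have harg : (1 - 1 / r) * k + 1 / r * (k + r) = k + 1 := by field_simp; ring
  rw [harg, Real.Gamma_add_one hk'.ne'] at h
  have h2 := Real.rpow_le_rpow (by positivity) h hr0.le
  rw [Real.mul_rpow hk'.le hG.le, Real.mul_rpow (by positivity) (by positivity),
    ← Real.rpow_mul hG.le, ← Real.rpow_mul hG2.le, one_div_mul_cancel hr0.ne', Real.rpow_one,
    show (1 - 1 / r) * r = r - 1 by field_simp, Real.rpow_sub_one hG.ne'] at h2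
  have h3 := mul_le_mul_of_nonneg_right h2 hG.le
  have e1 : (k : ℝ) ^ r * Real.Gamma k ^ r * Real.Gamma k =
      (k : ℝ) ^ r * Real.Gamma k * Real.Gamma k ^ r := by ring
  have e2 : Real.Gamma k ^ r / Real.Gamma k * Real.Gamma (k + r) * Real.Gamma k =
      Real.Gamma (k + r) * Real.Gamma k ^ r := by field_simp
  rw [e1, e2] at h3
  exact le_of_mul_le_mul_right h3 (by positivity)

/-- The generating function of the rising factorials: an upper moment bound for a geometric
variable with mean `1 + c`. -/
lemma tsum_rpow_mul_geometric_le_Gamma {c r : ℝ} (hc : 0 ≤ c) (hr : 1 ≤ r) :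
    ∑' k : ℕ, ENNReal.ofReal (((k : ℝ) + 1) ^ r) * ENNReal.ofReal (c ^ k / (1 + c) ^ (k + 1)) ≤
      ENNReal.ofReal (Real.Gamma (1 + r) * (1 + c) ^ r) := by
  have h1c : 0 < 1 + c := by linarith
  set q := c / (1 + c) with hq
  have hq0 : 0 ≤ q := by positivity
  have hq1 : 1 - q = (1 + c)⁻¹ := by rw [hq]; field_simp; ring
  -- The power is bounded by Γ(k + 1 + r) / k!. Writing this Γ as an integral turns the sum over k
  -- into the series of e^{qx}, leaving a Gamma integral of rate 1 - q = 1 / (1 + c).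
  have hterm : ∀ k : ℕ, ENNReal.ofReal (((k : ℝ) + 1) ^ r) *
      ENNReal.ofReal (c ^ k / (1 + c) ^ (k + 1)) ≤
      ∫⁻ x in Set.Ioi (0 : ℝ), ENNReal.ofReal ((1 + c)⁻¹ * (x ^ r * Real.exp (-x)) *
        ((q * x) ^ k / k.factorial)) := by
    intro k
    have hpos : (0 : ℝ) < k + 1 + r := by positivity
    have hint : IntegrableOn (fun x : ℝ => Real.exp (-x) * x ^ ((k : ℝ) + 1 + r - 1)) (Set.Ioi 0) :=
      Real.GammaIntegral_convergent hpos
    have hG := Real.natCast_rpow_le_Gamma_div (Nat.succ_pos k) hr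
    rw [Nat.cast_succ, Real.Gamma_nat_eq_factorial, Real.Gamma_eq_integral hpos] at hG
    rw [← ENNReal.ofReal_mul (by positivity)]
    calc ENNReal.ofReal (((k : ℝ) + 1) ^ r * (c ^ k / (1 + c) ^ (k + 1)))
        ≤ ENNReal.ofReal ((∫ x in Set.Ioi (0 : ℝ), Real.exp (-x) * x ^ ((k : ℝ) + 1 + r - 1)) *
            ((c ^ k / (1 + c) ^ (k + 1)) / k.factorial)) := by
          refine ENNReal.ofReal_le_ofReal ?_
          calc _ ≤ ((∫ x in Set.Ioi (0 : ℝ), Real.exp (-x) * x ^ ((k : ℝ) + 1 + r - 1)) /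
                k.factorial) * (c ^ k / (1 + c) ^ (k + 1)) :=
                mul_le_mul_of_nonneg_right hG (by positivity)
            _ = _ := by ring
      _ = ENNReal.ofReal (∫ x in Set.Ioi (0 : ℝ), (1 + c)⁻¹ * (x ^ r * Real.exp (-x)) *
        ((q * x) ^ k / k.factorial)) := by
          rw [← integral_mul_const]
          congr 1
          refine setIntegral_congr_fun measurableSet_Ioi fun x hx => ?_
          have hx0 : (0 : ℝ) < x := hx
          rw [show (k : ℝ) + 1 + r - 1 = r + k by ring, Real.rpow_add hx0, Real.rpow_natCast, hq,
            mul_pow, div_pow, pow_succ]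
          field_simp
      _ = _ := by
          rw [ofReal_integral_eq_lintegral_ofReal]
          · refine IntegrableOn.congr_fun (hint.const_mul ((1 + c)⁻¹ * (q ^ k / k.factorial)))
              (fun x hx => ?_) measurableSet_Ioi
            have hx0 : (0 : ℝ) < x := hx
            rw [show (k : ℝ) + 1 + r - 1 = r + k by ring, Real.rpow_add hx0, Real.rpow_natCast,
              mul_pow]
            ring
          · refine (ae_restrict_iff' measurableSet_Ioi).2 (ae_of_all _ fun x hx => ?_)
            have hx0 : (0 : ℝ) < x := hx
            positivity
  refine (ENNReal.tsum_le_tsum hterm).trans (le_of_eq ?_)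
  rw [← lintegral_tsum fun k => by fun_prop]
  have hsum : ∀ x ∈ Set.Ioi (0 : ℝ), ∑' k : ℕ, ENNReal.ofReal ((1 + c)⁻¹ *
      (x ^ r * Real.exp (-x)) * ((q * x) ^ k / k.factorial)) =
      ENNReal.ofReal ((1 + c)⁻¹ * (x ^ ((r + 1) - 1) * Real.exp (-((1 + c)⁻¹ * x)))) := by
    intro x hx
    have hx0 : (0 : ℝ) < x := hx
    have hs : HasSum (fun k : ℕ => (q * x) ^ k / (k.factorial : ℝ)) (Real.exp (q * x)) := by
      rw [Real.exp_eq_exp_ℝ]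
      exact NormedSpace.expSeries_div_hasSum_exp (q * x)
    have hs2 := hs.mul_left ((1 + c)⁻¹ * (x ^ r * Real.exp (-x)))
    rw [← ENNReal.ofReal_tsum_of_nonneg (fun k => by positivity) hs2.summable, hs2.tsum_eq]
    congr 1
    rw [add_sub_cancel_right, ← hq1, mul_assoc, mul_assoc, ← Real.exp_add]
    ring_nf
  rw [setLIntegral_congr_fun measurableSet_Ioi hsum]
  have hval : ∫ x in Set.Ioi (0 : ℝ), (1 + c)⁻¹ * (x ^ ((r + 1) - 1) *
      Real.exp (-((1 + c)⁻¹ * x))) = Real.Gamma (1 + r) * (1 + c) ^ r := by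
    rw [integral_const_mul, Real.integral_rpow_mul_exp_neg_mul_Ioi (by linarith) (by positivity),
      one_div, inv_inv, Real.rpow_add_one h1c.ne', add_comm r 1]
    field_simp
  have hGpos : 0 < Real.Gamma (1 + r) := Real.Gamma_pos_of_pos (by linarith)
  rw [← ofReal_integral_eq_lintegral_ofReal, hval]
  · by_contra h
    rw [integral_undef h] at hval
    have : 0 < Real.Gamma (1 + r) * (1 + c) ^ r := by positivity
    linarith
  · refine (ae_restrict_iff' measurableSet_Ioi).2 (ae_of_all _ fun x hx => ?_)
    have hx0 : (0 : ℝ) < x := hx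
    positivity

/-- Jensen for the concave power: x^r lies below its tangent at the mean 1 + c, and the linear term
averages to zero. -/
lemma tsum_rpow_mul_geometric_le {c r : ℝ} (hc : 0 ≤ c) (hr0 : 0 ≤ r) (hr1 : r ≤ 1) :
    ∑' k : ℕ, ENNReal.ofReal (((k : ℝ) + 1) ^ r) * ENNReal.ofReal (c ^ k / (1 + c) ^ (k + 1)) ≤
      ENNReal.ofReal ((1 + c) ^ r) := by
  have h1c : 0 < 1 + c := by linarith
  set q := c / (1 + c) with hq
  have hq0 : 0 ≤ q := by positivity
  have hq1 : q < 1 := by rw [hq, div_lt_one h1c]; linarith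
  have hqc : 1 - q = (1 + c)⁻¹ := by rw [hq]; field_simp; ring
  have hs1 : HasSum (fun k : ℕ => q ^ k) (1 + c) := by
    have := hasSum_geometric_of_lt_one hq0 hq1
    rwa [hqc, inv_inv] at this
  have hs2 : HasSum (fun k : ℕ => (k : ℝ) * q ^ k) (c * (1 + c)) := by
    have := hasSum_coe_mul_geometric_of_norm_lt_one (r := q)
      (by rwa [Real.norm_of_nonneg hq0])
    have he : q / (1 + c)⁻¹ ^ 2 = c * (1 + c) := by
      rw [hq]; field_simp
    rwa [hqc, he] at this
  have hterm : ∀ k : ℕ, ((k : ℝ) + 1) ^ r * (c ^ k / (1 + c) ^ (k + 1)) ≤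
      (1 + c) ^ r * ((1 - r) / (1 + c) * q ^ k + r / (1 + c) ^ 2 * (k * q ^ k + q ^ k)) := by
    intro k
    have hB : ((k : ℝ) + 1) ^ r ≤ (1 + c) ^ r * (1 + r * (((k : ℝ) + 1) / (1 + c) - 1)) := by
      have h := rpow_one_add_le_one_add_mul_self (s := ((k : ℝ) + 1) / (1 + c) - 1)
        (by have : 0 ≤ ((k : ℝ) + 1) / (1 + c) := by positivity
            linarith) hr0 hr1
      rw [add_sub_cancel, Real.div_rpow (by positivity) h1c.le,
        div_le_iff₀ (by positivity)] at h
      linarith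
    have hqk : c ^ k / (1 + c) ^ (k + 1) = q ^ k / (1 + c) := by
      rw [hq, div_pow, pow_succ]; field_simp
    rw [hqk]
    refine (mul_le_mul_of_nonneg_right hB (by positivity)).trans (le_of_eq ?_)
    field_simp
    ring
  have hs := (((hs1.mul_left ((1 - r) / (1 + c))).add
    ((hs2.add hs1).mul_left (r / (1 + c) ^ 2)))).mul_left ((1 + c) ^ r)
  have hval : (1 + c) ^ r * ((1 - r) / (1 + c) * (1 + c) +
      r / (1 + c) ^ 2 * (c * (1 + c) + (1 + c))) = (1 + c) ^ r := by
    field_simp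
    ring
  rw [hval] at hs
  rw [← hs.tsum_eq, ENNReal.ofReal_tsum_of_nonneg _ hs.summable]
  · refine ENNReal.tsum_le_tsum fun k => ?_
    rw [← ENNReal.ofReal_mul (by positivity)]
    exact ENNReal.ofReal_le_ofReal (hterm k)
  · intro k
    exact (by positivity : (0 : ℝ) ≤ ((k : ℝ) + 1) ^ r * (c ^ k / (1 + c) ^ (k + 1))).trans (hterm k)

/-- The constant in the moment bound for a geometric variable. -/
noncomputable def momentConst (r : ℝ) : ℝ := if r < 1 then 1 else Real.Gamma (1 + r)

lemma momentConst_pos {r : ℝ} (hr : 0 < r) : 0 < momentConst r := by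
  unfold momentConst
  split_ifs
  · exact one_pos
  · exact Real.Gamma_pos_of_pos (by linarith)

lemma tsum_rpow_mul_geometric_le_momentConst {c r : ℝ} (hc : 0 ≤ c) (hr : 0 < r) :
    ∑' k : ℕ, ENNReal.ofReal (((k : ℝ) + 1) ^ r) * ENNReal.ofReal (c ^ k / (1 + c) ^ (k + 1)) ≤
      ENNReal.ofReal (momentConst r * (1 + c) ^ r) := by
  unfold momentConst
  split_ifs with h
  · rw [one_mul]
    exact tsum_rpow_mul_geometric_le hc hr.le h.le
  · exact tsum_rpow_mul_geometric_le_Gamma hc (not_lt.1 h)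

/-- Multiplying numerator and denominator by x^(k+1) shows that A^k / (A + 1/x)^(k+1) is x times the
geometric weight with c = xA, and c ≤ x. -/
lemma tsum_rpow_mul_pow_mul_inv_le {x A B : ℝ≥0∞} (hx0 : x ≠ 0) (hx : x ≠ ∞) (hA : A ≤ 1)
    (hAB : A + x⁻¹ = 1 + B) {r : ℝ} (hr : 0 < r) :
    ∑' k : ℕ, ENNReal.ofReal (((k : ℝ) + 1) ^ r) * (A ^ k * ((1 + B) ^ (k + 1))⁻¹) ≤
      ENNReal.ofReal (momentConst r) * (x * (1 + x) ^ r) := by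
  have hAt : A ≠ ∞ := ne_top_of_le_ne_top ENNReal.one_ne_top hA
  set y := x.toReal with hy
  have hy0 : 0 < y := ENNReal.toReal_pos hx0 hx
  set a := A.toReal with ha
  have ha0 : 0 ≤ a := ENNReal.toReal_nonneg
  have ha1 : a ≤ 1 := by simpa using ENNReal.toReal_mono ENNReal.one_ne_top hA
  have hxy : x = ENNReal.ofReal y := (ENNReal.ofReal_toReal hx).symm
  have hAa : A = ENNReal.ofReal a := (ENNReal.ofReal_toReal hAt).symm
  set c := y * a with hc
  have hc0 : 0 ≤ c := by positivity
  have hterm : ∀ k : ℕ, A ^ k * ((1 + B) ^ (k + 1))⁻¹ =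
      ENNReal.ofReal y * ENNReal.ofReal (c ^ k / (1 + c) ^ (k + 1)) := by
    intro k
    have hsum : 0 < a + y⁻¹ := by positivity
    rw [← hAB, hAa, hxy, ← ENNReal.ofReal_inv_of_pos hy0, ← ENNReal.ofReal_add ha0 (by positivity),
      ← ENNReal.ofReal_pow hsum.le, ← ENNReal.ofReal_inv_of_pos (by positivity),
      ← ENNReal.ofReal_pow ha0, ← ENNReal.ofReal_mul (by positivity),
      ← ENNReal.ofReal_mul hy0.le]
    congr 1
    have : 1 + c = y * (a + y⁻¹) := by rw [hc]; field_simp; ring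
    rw [this, hc, mul_pow, mul_pow, pow_succ y k]
    field_simp
  simp_rw [hterm, mul_left_comm _ (ENNReal.ofReal y)]
  rw [ENNReal.tsum_mul_left, mul_left_comm, ← hxy]
  gcongr
  refine (tsum_rpow_mul_geometric_le_momentConst hc0 hr).trans ?_
  rw [ENNReal.ofReal_mul (momentConst_pos hr).le, ← ENNReal.ofReal_rpow_of_pos (by positivity)]
  gcongr
  rw [ENNReal.ofReal_add zero_le_one hc0, ENNReal.ofReal_one, hxy]
  gcongr
  rw [hc]
  exact mul_le_of_le_one_right hy0.le ha1

/-! ### Moments of the index and of the density -/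

section Moments

variable {𝓤 : Type*} [MeasurableSpace 𝓤] {Q : Measure 𝓤} [IsProbabilityMeasure Q] {f : 𝓤 → ℝ≥0∞}

lemma tsum_rpow_mul_measure_minimizerEvent_le (hf : Measurable f) (h1 : ∫⁻ v, f v ∂Q = 1)
    {r : ℝ} (hr : 0 < r) :
    ∑' k : ℕ, ENNReal.ofReal (((k : ℝ) + 1) ^ r) *
        (expSeq.prod (Measure.infinitePi fun _ : ℕ => Q)) (minimizerEvent f k) ≤
      ENNReal.ofReal (momentConst r) * ∫⁻ w, f w * (1 + f w) ^ r ∂Q := by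
  set G : Set 𝓤 := {w | f w ≠ 0 ∧ f w ≠ ∞}
  have hG : MeasurableSet G := measurableSet_ne_zero_ne_top hf
  have hAm : Measurable fun w => ∫⁻ v, (1 - (f w)⁻¹ * f v) ∂Q :=
    Measurable.lintegral_prod_right (f := fun w v => 1 - (f w)⁻¹ * f v) (by fun_prop)
  have hBm : Measurable fun w => ∫⁻ v, ((f w)⁻¹ * f v - 1) ∂Q :=
    Measurable.lintegral_prod_right (f := fun w v => (f w)⁻¹ * f v - 1) (by fun_prop)
  calc _ ≤ ∑' k : ℕ, ENNReal.ofReal (((k : ℝ) + 1) ^ r) *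
        ∫⁻ w in G, (∫⁻ v, (1 - (f w)⁻¹ * f v) ∂Q) ^ k *
        ((1 + ∫⁻ v, ((f w)⁻¹ * f v - 1) ∂Q) ^ (k + 1))⁻¹ ∂Q := by
        gcongr with k
        exact measure_minimizerEvent_le Q hf (by simp [h1]) k
    _ = ∫⁻ w in G, ∑' k : ℕ, ENNReal.ofReal (((k : ℝ) + 1) ^ r) *
        ((∫⁻ v, (1 - (f w)⁻¹ * f v) ∂Q) ^ k *
        ((1 + ∫⁻ v, ((f w)⁻¹ * f v - 1) ∂Q) ^ (k + 1))⁻¹) ∂Q := by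
        rw [lintegral_tsum fun k => by fun_prop]
        refine tsum_congr fun k => ?_
        rw [lintegral_const_mul _ (by fun_prop)]
    _ ≤ ∫⁻ w in G, ENNReal.ofReal (momentConst r) * (f w * (1 + f w) ^ r) ∂Q := by
        refine setLIntegral_mono (by fun_prop) fun w hw => ?_
        refine tsum_rpow_mul_pow_mul_inv_le hw.1 hw.2 ?_ ?_ hr
        · calc _ ≤ ∫⁻ _, 1 ∂Q := lintegral_mono fun v => tsub_le_self
            _ = 1 := by simp
        -- With z = f / f(w), the identity A + E z = 1 + B integrates the two expressions (1 - z)⁺ +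
        -- z and 1 + (z - 1)⁺ for max(1, z).
        · have hz : ∫⁻ v, (f w)⁻¹ * f v ∂Q = (f w)⁻¹ := by
            rw [lintegral_const_mul _ hf, h1, mul_one]
          have hone : ∫⁻ _ : 𝓤, (1 : ℝ≥0∞) ∂Q = 1 := by simp
          calc _ = ∫⁻ v, (1 - (f w)⁻¹ * f v) ∂Q + ∫⁻ v, (f w)⁻¹ * f v ∂Q := by rw [hz]
            _ = ∫⁻ v, (1 + ((f w)⁻¹ * f v - 1)) ∂Q := by
                rw [← lintegral_add_right _ (by fun_prop)]
                refine lintegral_congr fun v => ?_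
                rw [tsub_add_eq_max, add_comm 1, tsub_add_eq_max, max_comm]
            _ = _ := by rw [lintegral_add_left measurable_const, hone]
    _ ≤ _ := by
        rw [← lintegral_const_mul _ (by fun_prop)]
        exact setLIntegral_le_lintegral _ _

/-- Jensen through the tangent line at 1, with the negative constant moved across to remain in
`ℝ≥0∞`. -/
lemma one_le_lintegral_rpow (hf : Measurable f) (h1 : ∫⁻ v, f v ∂Q = 1) {r : ℝ} (hr : 0 < r) :
    1 ≤ ∫⁻ v, f v ^ (1 + r) ∂Q := by
  have hpt : ∀ v, ENNReal.ofReal (1 + r) * f v ≤ f v ^ (1 + r) + ENNReal.ofReal r := by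
    intro v
    by_cases hv : f v = ∞
    · rw [hv, ENNReal.top_rpow_of_pos (by linarith)]
      simp
    · rw [← ENNReal.ofReal_toReal hv]
      have hy : 0 ≤ (f v).toReal := ENNReal.toReal_nonneg
      rw [ENNReal.ofReal_rpow_of_nonneg hy (by linarith), ← ENNReal.ofReal_mul (by linarith),
        ← ENNReal.ofReal_add (by positivity) hr.le]
      refine ENNReal.ofReal_le_ofReal ?_
      have := one_add_mul_self_le_rpow_one_add (s := (f v).toReal - 1) (by linarith)
        (show 1 ≤ 1 + r by linarith)
      rw [add_sub_cancel] at this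
      linarith
  have h := lintegral_mono (μ := Q) hpt
  rw [lintegral_const_mul _ hf, h1, mul_one, lintegral_add_right _ measurable_const,
    lintegral_const, measure_univ, mul_one, ENNReal.ofReal_add zero_le_one hr.le,
    ENNReal.ofReal_one] at h
  exact (ENNReal.add_le_add_iff_right ENNReal.ofReal_ne_top).1 h

lemma lintegral_rpow_le_one (hf : Measurable f) (h1 : ∫⁻ v, f v ∂Q = 1) {r : ℝ} (hr : 0 < r)
    (hr1 : r ≤ 1) : ∫⁻ v, f v ^ r ∂Q ≤ 1 := by
  have hpt : ∀ v, f v ^ r ≤ ENNReal.ofReal r * f v + ENNReal.ofReal (1 - r) := by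
    intro v
    by_cases hv : f v = ∞
    · rw [hv, ENNReal.mul_top (by simpa using hr)]
      simp
    · rw [← ENNReal.ofReal_toReal hv]
      have hy : 0 ≤ (f v).toReal := ENNReal.toReal_nonneg
      rw [ENNReal.ofReal_rpow_of_nonneg hy hr.le, ← ENNReal.ofReal_mul hr.le,
        ← ENNReal.ofReal_add (by positivity) (by linarith)]
      refine ENNReal.ofReal_le_ofReal ?_
      have := rpow_one_add_le_one_add_mul_self (s := (f v).toReal - 1) (by linarith) hr.le hr1
      rw [add_sub_cancel] at this
      linarith
  refine (lintegral_mono hpt).trans ?_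
  rw [lintegral_add_right _ measurable_const, lintegral_const_mul _ hf, h1, lintegral_const,
    measure_univ, mul_one, mul_one, ← ENNReal.ofReal_add hr.le (by linarith)]
  simp

/-- Bernoulli gives f (1 + f)^r = f^(1+r) (1 + 1/f)^r ≤ f^(1+r) + r f^r, and E f^r ≤ 1 ≤ E f^(1+r).
-/
lemma lintegral_mul_one_add_rpow_le (hf : Measurable f) (h1 : ∫⁻ v, f v ∂Q = 1) {r : ℝ}
    (hr : 0 < r) (hr1 : r ≤ 1) :
    ∫⁻ v, f v * (1 + f v) ^ r ∂Q ≤ ENNReal.ofReal (1 + r) * ∫⁻ v, f v ^ (1 + r) ∂Q := by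
  have hpt : ∀ v, f v * (1 + f v) ^ r ≤ f v ^ (1 + r) + ENNReal.ofReal r * f v ^ r := by
    intro v
    by_cases hv : f v = ∞
    · rw [hv, ENNReal.top_rpow_of_pos (by linarith)]
      simp
    · rw [← ENNReal.ofReal_toReal hv]
      have hy : 0 ≤ (f v).toReal := ENNReal.toReal_nonneg
      rcases hy.eq_or_lt with h0 | hpos
      · simp [← h0]
      set y := (f v).toReal
      rw [← ENNReal.ofReal_one, ← ENNReal.ofReal_add zero_le_one hy,
        ENNReal.ofReal_rpow_of_nonneg hy (by linarith),
        ENNReal.ofReal_rpow_of_nonneg (by linarith) hr.le,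
        ENNReal.ofReal_rpow_of_nonneg hy hr.le, ← ENNReal.ofReal_mul hr.le,
        ← ENNReal.ofReal_mul hy, ← ENNReal.ofReal_add (by positivity) (by positivity)]
      refine ENNReal.ofReal_le_ofReal ?_
      have h := rpow_one_add_le_one_add_mul_self (s := y⁻¹)
        ((by norm_num : (-1 : ℝ) ≤ 0).trans (by positivity)) hr.le hr1
      have hfac : (1 + y) ^ r = y ^ r * (1 + y⁻¹) ^ r := by
        rw [← Real.mul_rpow hy (by positivity), mul_add, mul_inv_cancel₀ hpos.ne', mul_one,
          add_comm]
      rw [hfac, Real.rpow_one_add' hy (by positivity)]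
      calc y * (y ^ r * (1 + y⁻¹) ^ r) ≤ y * (y ^ r * (1 + r * y⁻¹)) := by gcongr
        _ = _ := by field_simp
  refine (lintegral_mono hpt).trans ?_
  rw [lintegral_add_right _ (by fun_prop), lintegral_const_mul _ (by fun_prop),
    ENNReal.ofReal_add zero_le_one hr.le, ENNReal.ofReal_one, add_mul, one_mul]
  refine add_le_add le_rfl (mul_le_mul_right ?_ _)
  exact (lintegral_rpow_le_one hf h1 hr hr1).trans (one_le_lintegral_rpow hf h1 hr)

/-- Convexity gives (1 + f)^r ≤ 2^(r-1) (1 + f^r); the term E f = 1 is absorbed by E f^(1+r) ≥ 1, at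
the cost of one more factor 2. -/
lemma lintegral_mul_one_add_rpow_le_two_rpow (hf : Measurable f) (h1 : ∫⁻ v, f v ∂Q = 1) {r : ℝ}
    (hr1 : 1 ≤ r) :
    ∫⁻ v, f v * (1 + f v) ^ r ∂Q ≤ (2 : ℝ≥0∞) ^ r * ∫⁻ v, f v ^ (1 + r) ∂Q := by
  have hM := one_le_lintegral_rpow hf h1 (show 0 < r by linarith)
  have hpt : ∀ v, f v * (1 + f v) ^ r ≤ (2 : ℝ≥0∞) ^ (r - 1) * (f v + f v ^ (1 + r)) := by
    intro v
    have h := ENNReal.rpow_add_le_mul_rpow_add_rpow 1 (f v) hr1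
    rw [ENNReal.one_rpow] at h
    refine (mul_le_mul_right h _).trans (le_of_eq ?_)
    rw [ENNReal.rpow_add_of_nonneg 1 r zero_le_one (by linarith), ENNReal.rpow_one]
    ring
  refine (lintegral_mono hpt).trans ?_
  rw [lintegral_const_mul _ (by fun_prop), lintegral_add_left hf, h1]
  calc _ ≤ (2 : ℝ≥0∞) ^ (r - 1) * (∫⁻ v, f v ^ (1 + r) ∂Q + ∫⁻ v, f v ^ (1 + r) ∂Q) := by gcongr
    _ = (2 : ℝ≥0∞) ^ (r - 1) * 2 ^ (1 : ℝ) * ∫⁻ v, f v ^ (1 + r) ∂Q := by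
      rw [ENNReal.rpow_one, mul_assoc, two_mul]
    _ = _ := by
      rw [← ENNReal.rpow_add _ _ (by simp) (by simp), sub_add_cancel]

end Moments

/-! ### Transfer to the canonical product space -/

lemma sum_Icc_one_succPNat {M : Type*} [AddCommMonoid M] (g : ℕ+ → M) (n : ℕ) :
    ∑ j ∈ Finset.Icc 1 n.succPNat, g j = ∑ j ∈ Finset.range (n + 1), g j.succPNat := by
  refine Finset.sum_nbij' PNat.natPred Nat.succPNat (fun a ha => ?_) (fun a ha => ?_)
    (fun a _ => PNat.succPNat_natPred a) (fun a _ => Nat.natPred_succPNat a)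
    (fun a _ => by rw [PNat.succPNat_natPred])
  · rw [Finset.mem_range]
    have h := PNat.coe_le_coe _ _ |>.2 (Finset.mem_Icc.1 ha).2
    rw [Nat.succPNat_coe] at h
    have := PNat.natPred_add_one a
    omega
  · rw [Finset.mem_Icc]
    refine ⟨one_le, PNat.coe_le_coe _ _ |>.1 ?_⟩
    rw [Nat.succPNat_coe, Nat.succPNat_coe]
    have := Finset.mem_range.1 ha
    omega

/-- The joint law of the interarrival times and the marks. -/
lemma IsPoissonSetup.exists_interarrival {Ω 𝓤 : Type*} [MeasurableSpace Ω] [MeasurableSpace 𝓤]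
    {T : ℕ+ → Ω → ℝ} {U : ℕ+ → Ω → 𝓤} {Q : Measure 𝓤} [IsProbabilityMeasure Q] {μ : Measure Ω}
    [IsProbabilityMeasure μ] (h : IsPoissonSetup T U Q μ) :
    ∃ X : Ω → (ℕ → ℝ) × (ℕ → 𝓤), Measurable X ∧
      (∀ n ω, T n.succPNat ω = partialSum (X ω).1 n) ∧ (∀ n ω, U n.succPNat ω = (X ω).2 n) ∧
      μ.map X = expSeq.prod (Measure.infinitePi fun _ : ℕ => Q) := by
  obtain ⟨τ, hτm, hτi, hτl, hT⟩ := h.poisson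
  obtain ⟨hUm, hUi, hUl⟩ := h.iid
  have hTs : ∀ n ω, T n.succPNat ω = partialSum (fun j => τ j.succPNat ω) n := fun n ω => by
    rw [hT, sum_Icc_one_succPNat, partialSum]
  have hm1 : Measurable fun ω (n : ℕ) => τ n.succPNat ω := measurable_pi_iff.2 fun n => hτm _
  have hm2 : Measurable fun ω (n : ℕ) => U n.succPNat ω := measurable_pi_iff.2 fun n => hUm _
  refine ⟨fun ω => (fun n => τ n.succPNat ω, fun n => U n.succPNat ω), hm1.prodMk hm2, hTs,
    fun n ω => rfl, ?_⟩
  have hlaw1 : μ.map (fun ω (n : ℕ) => τ n.succPNat ω) = expSeq := by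
    rw [(hτi.precomp Nat.succPNat_injective).map_fun_eq_infinitePi_map fun n => hτm _]
    simp_rw [hτl]
  have hlaw2 : μ.map (fun ω (n : ℕ) => U n.succPNat ω) = Measure.infinitePi fun _ : ℕ => Q := by
    rw [(hUi.precomp Nat.succPNat_injective).map_fun_eq_infinitePi_map fun n => hUm _]
    simp_rw [hUl]
  -- Independence from the marks is assumed for the points `T` only; the gaps inherit it as a
  -- measurable function of the points.
  let φ : (ℕ+ → ℝ) → ℕ → ℝ := fun t n => t n.succPNat - if n = 0 then 0 else t (n - 1).succPNat
  have hφ : Measurable φ := by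
    refine measurable_pi_iff.2 fun n => (measurable_pi_apply _).sub ?_
    split_ifs
    · exact measurable_const
    · exact measurable_pi_apply _
  have hind := h.indep.comp (ψ := fun u (n : ℕ) => u n.succPNat) hφ
    (measurable_pi_iff.2 fun n => measurable_pi_apply _)
  have hφT : φ ∘ (fun ω i => T i ω) = fun ω (n : ℕ) => τ n.succPNat ω := by
    funext ω n
    simp only [φ, Function.comp, hTs]
    cases n with
    | zero => simp [partialSum]
    | succ n => simp [partialSum, Finset.sum_range_succ _ (n + 1)]
  rw [hφT] at hind
  have := (indepFun_iff_map_prod_eq_prod_map_map hm1.aemeasurable hm2.aemeasurable).1 hind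
  rw [hlaw1] at this
  exact this.trans (congrArg _ hlaw2)

/-! ### Almost sure existence and uniqueness of the minimizer -/

lemma lintegral_partialSum (k : ℕ) (x : ℝ) {φ : ℝ → ℝ≥0∞} (hφ : Measurable φ) :
    ∫⁻ τ, φ (x + partialSum τ k) ∂expSeq = ∫⁻ s in Set.Ioi x, ENNReal.ofReal (Real.exp (-(s - x))) *
      (ENNReal.ofReal (s - x) ^ k / (k.factorial : ℝ≥0∞)) * φ s := by
  have := lintegral_palm (m := fun _ _ => 1) measurable_const (fun s => monotone_const)
    (fun _ _ => ENNReal.one_ne_top) k 0 x hφ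
  simpa [survival_zero] using this

lemma expSeq_add_partialSum_eq (k : ℕ) (x d : ℝ) : expSeq {τ | x + partialSum τ k = d} = 0 := by
  have hm : Measurable fun τ => x + partialSum τ k := (measurable_partialSum k).const_add x
  have h := lintegral_partialSum k x (φ := Set.indicator {d} 1)
    (measurable_one.indicator (measurableSet_singleton d))
  have hl : ∫⁻ τ, Set.indicator {d} 1 (x + partialSum τ k) ∂expSeq =
      expSeq {τ | x + partialSum τ k = d} := by
    have hset : MeasurableSet {τ | x + partialSum τ k = d} := hm (measurableSet_singleton d)
    rw [← lintegral_indicator_one hset]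
    rfl
  rw [← hl, h]
  refine lintegral_eq_zero_of_ae_eq_zero ?_
  have : ∀ᵐ s ∂(volume.restrict (Set.Ioi x)), s ≠ d :=
    ae_restrict_of_ae (Measure.ae_ne volume d)
  filter_upwards [this] with s hs
  simp [hs]

/-- The offsets x and y absorb the first gap, so both indices drop by one. When i reaches 0, the
right side is fixed by the first gap, while the left side still contains a sum with a density. -/
lemma expSeq_partialSum_eq_mul_partialSum {i j : ℕ} (hij : i < j) (c x y : ℝ) :
    expSeq {τ | x + partialSum τ j = c * (y + partialSum τ i)} = 0 := by
  obtain ⟨j, rfl⟩ : ∃ j', j = j' + 1 := ⟨j - 1, by omega⟩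
  induction i generalizing j x y with
  | zero =>
    have hm : MeasurableSet {τ : ℕ → ℝ | x + partialSum τ (j + 1) = c * (y + partialSum τ 0)} :=
      measurableSet_eq_fun ((measurable_partialSum _).const_add x)
        (((measurable_partialSum _).const_add y).const_mul c)
    rw [← lintegral_indicator_one hm,
      lintegral_infinitePi_seqCons _ (measurable_one.indicator hm)]
    refine lintegral_eq_zero_of_ae_eq_zero (ae_of_all _ fun t => ?_)
    have hpre : ∀ σ, Set.indicator {τ : ℕ → ℝ | x + partialSum τ (j + 1) =
        c * (y + partialSum τ 0)} (1 : (ℕ → ℝ) → ℝ≥0∞) (seqCons t σ) =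
        Set.indicator {σ | x + t + partialSum σ j = c * (y + t)} 1 σ := fun σ => by
      simp only [Set.indicator, Set.mem_ofPred_eq, partialSum_seqCons_succ,
        partialSum_seqCons_zero, add_assoc, Pi.one_apply]
    simp_rw [hpre]
    rw [lintegral_indicator_one (measurableSet_eq_fun ((measurable_partialSum _).const_add _)
      measurable_const)]
    exact expSeq_add_partialSum_eq j _ _
  | succ i ih =>
    obtain ⟨j, rfl⟩ : ∃ j', j = j' + 1 := ⟨j - 1, by omega⟩
    have hm : MeasurableSet {τ : ℕ → ℝ | x + partialSum τ (j + 1 + 1) =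
        c * (y + partialSum τ (i + 1))} :=
      measurableSet_eq_fun ((measurable_partialSum _).const_add x)
        (((measurable_partialSum _).const_add y).const_mul c)
    rw [← lintegral_indicator_one hm,
      lintegral_infinitePi_seqCons _ (measurable_one.indicator hm)]
    refine lintegral_eq_zero_of_ae_eq_zero (ae_of_all _ fun t => ?_)
    have hpre : ∀ σ, Set.indicator {τ : ℕ → ℝ | x + partialSum τ (j + 1 + 1) =
        c * (y + partialSum τ (i + 1))} (1 : (ℕ → ℝ) → ℝ≥0∞) (seqCons t σ) =
        Set.indicator {σ | x + t + partialSum σ (j + 1) = c * (y + t + partialSum σ i)} 1 σ :=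
      fun σ => by
        simp only [Set.indicator, Set.mem_ofPred_eq, partialSum_seqCons_succ, ← add_assoc,
          Pi.one_apply]
    simp_rw [hpre]
    rw [lintegral_indicator_one (measurableSet_eq_fun ((measurable_partialSum _).const_add _)
      (((measurable_partialSum _).const_add _).const_mul c))]
    exact ih _ _ j (by omega)

lemma ae_expSeq_partialSum_pos : ∀ᵐ τ ∂expSeq, ∀ i, 0 < partialSum τ i := by
  have h0 : ∀ᵐ t ∂(expMeasure 1), 0 < t := by
    have hI : MeasurableSet {t : ℝ | ¬ 0 < t} := measurableSet_Ioi.compl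
    have h := lintegral_expMeasure_add 0 (g := Set.indicator {t : ℝ | ¬ 0 < t} 1)
      (measurable_one.indicator hI)
    simp only [zero_add] at h
    rw [lintegral_indicator_one hI] at h
    rw [ae_iff, h]
    refine lintegral_eq_zero_of_ae_eq_zero
      ((ae_restrict_iff' measurableSet_Ioi).2 (ae_of_all _ fun s hs => ?_))
    have : (0 : ℝ) < s := hs
    simp [this]
  have h1 : ∀ᵐ τ ∂expSeq, ∀ j, 0 < τ j := ae_all_iff.2 fun j =>
    (measurePreserving_eval_infinitePi (fun _ : ℕ => expMeasure 1) j).quasiMeasurePreserving.ae h0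
  filter_upwards [h1] with τ hτ i
  exact Finset.sum_pos (fun j _ => hτ j) ⟨0, by simp⟩

section Minimizer

variable {𝓤 : Type*} [MeasurableSpace 𝓤] {Q : Measure 𝓤} [IsProbabilityMeasure Q] {f : 𝓤 → ℝ≥0∞}

lemma ae_infinitePi_exists_ne_zero (hf : Measurable f) (h0 : ∫⁻ v, f v ∂Q ≠ 0) :
    ∀ᵐ u ∂(Measure.infinitePi fun _ : ℕ => Q), ∃ i, f (u i) ≠ 0 := by
  have hZ : MeasurableSet {v | f v = 0} := measurableSet_eq_fun hf measurable_const
  have hlt : Q {v | f v = 0} < 1 := by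
    refine lt_of_le_of_ne prob_le_one fun h => h0 ?_
    refine lintegral_eq_zero_of_ae_eq_zero ?_
    exact (prob_compl_eq_zero_iff hZ).2 h
  rw [ae_iff]
  refine le_antisymm (ge_of_tendsto' (ENNReal.tendsto_pow_atTop_nhds_zero_of_lt_one hlt)
    fun n => ?_) zero_le
  have hpi := Measure.infinitePi_pi (fun _ : ℕ => Q) (s := Finset.range n)
    (t := fun _ => {v | f v = 0}) fun _ _ => hZ
  rw [Finset.prod_const, Finset.card_range] at hpi
  rw [← hpi]
  refine measure_mono fun u hu i _ => ?_
  simp only [Set.mem_ofPred_eq, not_exists, not_not] at hu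
  exact hu i

/-- Borel–Cantelli: the densities of the points sum to the constant 1, so the expected number of
such i is ∫_0^∞ Q(s < a f) ds = a E_Q f. -/
lemma ae_finite_setOf_partialSum_lt (hf : Measurable f) (hfin : ∫⁻ v, f v ∂Q ≠ ∞) (a : ℕ) :
    ∀ᵐ p ∂(expSeq.prod (Measure.infinitePi fun _ : ℕ => Q)),
      {i | ENNReal.ofReal (partialSum p.1 i) < a * f (p.2 i)}.Finite := by
  set E : ℕ → Set ((ℕ → ℝ) × (ℕ → 𝓤)) := fun i =>
    {p | ENNReal.ofReal (partialSum p.1 i) < a * f (p.2 i)} with hE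
  have hg : Measurable fun v => (a : ℝ≥0∞) * f v := hf.const_mul _
  have hEm : ∀ i, MeasurableSet (E i) := fun i =>
    measurableSet_lt ((measurable_partialSum i).comp measurable_fst).ennreal_ofReal
      (hg.comp ((measurable_pi_apply i).comp measurable_snd))
  set φ : ℝ → ℝ≥0∞ := fun s => Q {v | ENNReal.ofReal s < a * f v} with hφdef
  have hφ : Measurable φ := by
    have hset : MeasurableSet {q : ℝ × 𝓤 | ENNReal.ofReal q.1 < a * f q.2} :=
      measurableSet_lt measurable_fst.ennreal_ofReal (hg.comp measurable_snd)
    exact measurable_measure_prodMk_left hset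
  have hEi : ∀ i, (expSeq.prod (Measure.infinitePi fun _ : ℕ => Q)) (E i) =
      ∫⁻ s in Set.Ioi (0 : ℝ), ENNReal.ofReal (Real.exp (-s)) *
        (ENNReal.ofReal s ^ i / (i.factorial : ℝ≥0∞)) * φ s := by
    intro i
    have h := lintegral_partialSum i 0 hφ
    simp only [zero_add, sub_zero] at h
    rw [Measure.prod_apply (hEm i), ← h]
    refine lintegral_congr fun τ => ?_
    rw [hφdef]
    simp only
    rw [← (measurePreserving_eval_infinitePi (fun _ : ℕ => Q) i).measure_preimage
      (measurableSet_lt measurable_const hg).nullMeasurableSet]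
    rfl
  have hsum : ∑' i, (expSeq.prod (Measure.infinitePi fun _ : ℕ => Q)) (E i) ≠ ∞ := by
    simp_rw [hEi]
    rw [← lintegral_tsum fun i => by fun_prop]
    have hpt : ∀ s ∈ Set.Ioi (0 : ℝ), ∑' i : ℕ, ENNReal.ofReal (Real.exp (-s)) *
        (ENNReal.ofReal s ^ i / (i.factorial : ℝ≥0∞)) * φ s = φ s := by
      intro s hs
      have hs0 : (0 : ℝ) ≤ s := le_of_lt hs
      have hexp : HasSum (fun k : ℕ => s ^ k / (k.factorial : ℝ)) (Real.exp s) := by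
        rw [Real.exp_eq_exp_ℝ]
        exact NormedSpace.expSeries_div_hasSum_exp s
      have hterm : ∀ i : ℕ, ENNReal.ofReal s ^ i / (i.factorial : ℝ≥0∞) =
          ENNReal.ofReal (s ^ i / (i.factorial : ℝ)) := by
        intro i
        rw [ENNReal.ofReal_div_of_pos (by exact_mod_cast i.factorial_pos),
          ENNReal.ofReal_pow hs0, ENNReal.ofReal_natCast]
      simp_rw [hterm]
      rw [ENNReal.tsum_mul_right, ENNReal.tsum_mul_left,
        ← ENNReal.ofReal_tsum_of_nonneg (fun k => by positivity) hexp.summable, hexp.tsum_eq,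
        ← ENNReal.ofReal_mul (Real.exp_pos _).le, ← Real.exp_add]
      simp
    rw [setLIntegral_congr_fun measurableSet_Ioi hpt, lintegral_Ioi_measure_lt Q hg le_rfl]
    simp only [ENNReal.ofReal_zero, tsub_zero]
    rw [lintegral_const_mul _ hf]
    exact ENNReal.mul_ne_top (ENNReal.natCast_ne_top a) hfin
  filter_upwards [ae_finite_setOfPred_mem hsum] with p hp
  exact hp

lemma ae_partialSum_mul_ne (hf : Measurable f) {i j : ℕ} (hij : i < j) :
    ∀ᵐ p ∂(expSeq.prod (Measure.infinitePi fun _ : ℕ => Q)),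
      partialSum p.1 j ≠ (f (p.2 j)).toReal / (f (p.2 i)).toReal * partialSum p.1 i := by
  have hps : ∀ i, Measurable fun p : (ℕ → 𝓤) × (ℕ → ℝ) => partialSum p.2 i := fun i =>
    (measurable_partialSum i).comp measurable_snd
  have hfi : ∀ i, Measurable fun p : (ℕ → 𝓤) × (ℕ → ℝ) => (f (p.1 i)).toReal := fun i =>
    (hf.comp ((measurable_pi_apply i).comp measurable_fst)).ennreal_toReal
  have h : ∀ᵐ p ∂((Measure.infinitePi fun _ : ℕ => Q).prod expSeq),
      partialSum p.2 j ≠ (f (p.1 j)).toReal / (f (p.1 i)).toReal * partialSum p.2 i := by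
    rw [ae_iff]
    have hm : MeasurableSet {p : (ℕ → 𝓤) × (ℕ → ℝ) | ¬ partialSum p.2 j ≠
        (f (p.1 j)).toReal / (f (p.1 i)).toReal * partialSum p.2 i} :=
      (measurableSet_eq_fun (hps j) (((hfi j).div (hfi i)).mul (hps i))).compl.compl
    rw [Measure.measure_prod_null hm]
    refine ae_of_all _ fun u => ?_
    have := expSeq_partialSum_eq_mul_partialSum hij ((f (u j)).toReal / (f (u i)).toReal) 0 0
    simp only [zero_add] at this
    simpa using this
  exact Measure.measurePreserving_swap.quasiMeasurePreserving.ae h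

/-- A function whose sublevel sets are finite, and which takes no finite value twice, has a unique
minimizer. -/
lemma existsUnique_forall_le {ι : Type*} {r : ι → ℝ≥0∞} {i₀ : ι} (h0 : r i₀ ≠ ∞)
    (hfin : ∀ a : ℕ, {i | r i < a}.Finite) (hinj : ∀ i j, r i ≠ ∞ → r i = r j → i = j) :
    ∃! k, ∀ i, r k ≤ r i := by
  obtain ⟨a, ha⟩ := ENNReal.exists_nat_gt h0
  obtain ⟨k, hk, hmin⟩ := (hfin a).exists_minimalFor r _ ⟨i₀, ha⟩
  have hle : ∀ i, r k ≤ r i := by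
    intro i
    by_cases hi : r i < a
    · exact (le_total (r k) (r i)).elim id fun h => hmin hi h
    · exact (le_of_lt hk).trans (not_lt.1 hi)
  refine ⟨k, hle, fun k' hk' => ?_⟩
  have heq : r k = r k' := le_antisymm (hle k') (hk' k)
  exact (hinj k k' (ne_top_of_le_ne_top h0 (hle i₀)) heq).symm

/-- Almost surely some ratio is finite, sublevel sets are finite, and finite ratios are distinct. A
minimizer has finite ratio, hence nonzero density, which places it in `minimizerEvent`. -/
lemma ae_existsUnique_minimizer (hf : Measurable f) (h1 : ∫⁻ v, f v ∂Q = 1) :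
    ∀ᵐ p ∂(expSeq.prod (Measure.infinitePi fun _ : ℕ => Q)),
      (∃! k, ∀ i, ENNReal.ofReal (partialSum p.1 k) / f (p.2 k) ≤
        ENNReal.ofReal (partialSum p.1 i) / f (p.2 i)) ∧
      ∀ k, (∀ i, ENNReal.ofReal (partialSum p.1 k) / f (p.2 k) ≤
        ENNReal.ofReal (partialSum p.1 i) / f (p.2 i)) → p ∈ minimizerEvent f k := by
  have htop : ∀ᵐ v ∂Q, f v < ∞ := ae_lt_top hf (by simp [h1])
  have e1 : ∀ᵐ p ∂(expSeq.prod (Measure.infinitePi fun _ : ℕ => Q)), ∀ i, 0 < partialSum p.1 i :=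
    Measure.quasiMeasurePreserving_fst.ae ae_expSeq_partialSum_pos
  have e2 : ∀ᵐ p ∂(expSeq.prod (Measure.infinitePi fun _ : ℕ => Q)), ∀ i, f (p.2 i) < ∞ :=
    Measure.quasiMeasurePreserving_snd.ae (ae_all_iff.2 fun j =>
      (measurePreserving_eval_infinitePi (fun _ : ℕ => Q) j).quasiMeasurePreserving.ae htop)
  have e3 : ∀ᵐ p ∂(expSeq.prod (Measure.infinitePi fun _ : ℕ => Q)), ∃ i, f (p.2 i) ≠ 0 :=
    Measure.quasiMeasurePreserving_snd.ae (ae_infinitePi_exists_ne_zero hf (by simp [h1]))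
  have e4 := ae_all_iff.2 fun a : ℕ => ae_finite_setOf_partialSum_lt hf (Q := Q) (by simp [h1]) a
  have e5 : ∀ᵐ p ∂(expSeq.prod (Measure.infinitePi fun _ : ℕ => Q)), ∀ i j, i < j →
      partialSum p.1 j ≠ (f (p.2 j)).toReal / (f (p.2 i)).toReal * partialSum p.1 i := by
    refine ae_all_iff.2 fun i => ae_all_iff.2 fun j => ?_
    by_cases hij : i < j
    · filter_upwards [ae_partialSum_mul_ne hf (Q := Q) hij] with p hp _ using hp
    · exact ae_of_all _ fun p h => absurd h hij
  filter_upwards [e1, e2, e3, e4, e5] with p hpos hlt hex hfin hne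
  obtain ⟨i₀, hi₀⟩ := hex
  have hrfin : ∀ i, f (p.2 i) ≠ 0 → ENNReal.ofReal (partialSum p.1 i) / f (p.2 i) ≠ ∞ :=
    fun i hi => ENNReal.div_ne_top ENNReal.ofReal_ne_top hi
  have hrne : ∀ i, ENNReal.ofReal (partialSum p.1 i) / f (p.2 i) ≠ ∞ → f (p.2 i) ≠ 0 := by
    intro i h hi
    rw [hi, ENNReal.div_zero (by simpa using hpos i)] at h
    exact h rfl
  have hinj' : ∀ i j, i < j → f (p.2 i) ≠ 0 → f (p.2 j) ≠ 0 →
      ENNReal.ofReal (partialSum p.1 i) / f (p.2 i) ≠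
      ENNReal.ofReal (partialSum p.1 j) / f (p.2 j) := by
    intro i j hij hi hj heq
    apply hne i j hij
    have hi' := ENNReal.toReal_pos hi (hlt i).ne
    have hj' := ENNReal.toReal_pos hj (hlt j).ne
    have := congrArg ENNReal.toReal heq
    rw [ENNReal.toReal_div, ENNReal.toReal_div, ENNReal.toReal_ofReal (hpos i).le,
      ENNReal.toReal_ofReal (hpos j).le] at this
    field_simp at this ⊢
    linarith
  refine ⟨existsUnique_forall_le (hrfin i₀ hi₀) (fun a => (hfin a).subset fun i hi => ?_)
    fun i j hi heq => ?_, fun k hk => ⟨⟨?_, (hlt k).ne⟩, fun i => ?_⟩⟩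
  · exact (ENNReal.div_lt_iff (Or.inr (by simpa using hpos i)) (Or.inl (hlt i).ne)).1 hi
  · by_contra hij
    have hi' := hrne i hi
    have hj' := hrne j (heq ▸ hi)
    rcases lt_or_gt_of_ne hij with h | h
    · exact hinj' i j h hi' hj' heq
    · exact hinj' j i h hj' hi' heq.symm
  · exact hrne k (ne_top_of_le_ne_top (hrfin i₀ hi₀) (hk i₀))
  · rw [← mul_assoc, ← div_eq_mul_inv]
    exact ENNReal.mul_le_of_le_div (hk i)

end Minimizer

/-! ### Prefix codes from Kraft's inequality -/

/-- A prefix-free set of nonempty words is uniquely decodable. -/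
lemma InformationTheory.uniquelyDecodable_of_prefix_free {α : Type*} {S : Set (List α)}
    (hnil : [] ∉ S) (hpre : ∀ v ∈ S, ∀ w ∈ S, v <+: w → v = w) : UniquelyDecodable S := by
  intro L₁
  induction L₁ with
  | nil =>
    intro L₂ _ h₂ heq
    cases L₂ with
    | nil => rfl
    | cons w L₂ =>
      have hw : w = [] := by
        have := heq.symm
        simp only [List.flatten_nil, List.flatten_cons, List.append_eq_nil_iff] at this
        exact this.1
      exact absurd (hw ▸ h₂ w (by simp)) hnil
  | cons v L₁ ih =>
    intro L₂ h₁ h₂ heq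
    cases L₂ with
    | nil =>
      have hv : v = [] := by
        simp only [List.flatten_nil, List.flatten_cons, List.append_eq_nil_iff] at heq
        exact heq.1
      exact absurd (hv ▸ h₁ v (by simp)) hnil
    | cons w L₂ =>
      simp only [List.flatten_cons] at heq
      have hvS := h₁ v (by simp)
      have hwS := h₂ w (by simp)
      have hvw : v = w := by
        rcases List.prefix_or_prefix_of_prefix (List.prefix_append v L₁.flatten)
          (heq ▸ List.prefix_append w L₂.flatten) with h | h
        · exact hpre v hvS w hwS h
        · exact (hpre w hwS v hvS h).symm
      subst hvw
      rw [ih L₂ (fun x hx => h₁ x (by simp [hx])) (fun x hx => h₂ x (by simp [hx]))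
        (List.append_cancel_left heq)]

/-- The first `ℓ` binary digits of `a`, most significant first. -/
def binaryWord (ℓ a : ℕ) : List Bool := List.ofFn fun m : Fin ℓ => a.testBit (ℓ - 1 - m)

lemma length_binaryWord (ℓ a : ℕ) : (binaryWord ℓ a).length = ℓ := by simp [binaryWord]

lemma div_eq_of_binaryWord_prefix {ℓ d a b : ℕ} (ha : a < 2 ^ ℓ) (hb : b < 2 ^ (ℓ + d))
    (h : binaryWord ℓ a <+: binaryWord (ℓ + d) b) : b / 2 ^ d = a := by
  refine Nat.eq_of_testBit_eq fun i => ?_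
  rw [Nat.testBit_div_two_pow]
  by_cases hi : i < ℓ
  · have hlen : ℓ - 1 - i < (binaryWord ℓ a).length := by rw [length_binaryWord]; omega
    have := h.getElem hlen
    simp only [binaryWord, List.getElem_ofFn] at this
    rw [show ℓ - 1 - (ℓ - 1 - i) = i by omega,
      show ℓ + d - 1 - (ℓ - 1 - i) = d + i by omega] at this
    rw [add_comm]
    exact this.symm
  · have h1 : a < 2 ^ i := ha.trans_le (Nat.pow_le_pow_right two_pos (not_lt.1 hi))
    have h2 : b < 2 ^ (i + d) := hb.trans_le (Nat.pow_le_pow_right two_pos (by omega))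
    rw [Nat.testBit_lt_two_pow h1, Nat.testBit_lt_two_pow h2]

/-- The converse of the Kraft inequality, for nondecreasing codeword lengths. -/
lemma exists_prefix_free_code {ℓ : ℕ → ℕ} (hmono : Monotone ℓ)
    (hkraft : ∀ n, ∑ i ∈ Finset.range n, ((2 : ℝ) ^ ℓ i)⁻¹ ≤ 1) :
    ∃ C : ℕ → List Bool, (∀ i, (C i).length = ℓ i) ∧ ∀ i j, C i <+: C j → i = j := by
  -- The i-th codeword consists of the first ℓ i binary digits of ∑_{j<i} 2^{-ℓ j}, and `a i` is
  -- that number scaled by 2^{ℓ i}, an integer because lengths are nondecreasing.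
  set a : ℕ → ℕ := fun i => ∑ j ∈ Finset.range i, 2 ^ (ℓ i - ℓ j) with ha
  have hlt : ∀ i, a i < 2 ^ ℓ i := by
    intro i
    have h := hkraft (i + 1)
    rw [Finset.sum_range_succ] at h
    have hpos : (0 : ℝ) < ((2 : ℝ) ^ ℓ i)⁻¹ := by positivity
    have hcast : (a i : ℝ) = (2 : ℝ) ^ ℓ i * ∑ j ∈ Finset.range i, ((2 : ℝ) ^ ℓ j)⁻¹ := by
      rw [ha, Finset.mul_sum]
      push_cast
      refine Finset.sum_congr rfl fun j hj => ?_
      rw [pow_sub₀ _ two_ne_zero (hmono (Finset.mem_range.1 hj).le)]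
    have : (a i : ℝ) < (2 : ℝ) ^ ℓ i := by
      rw [hcast]
      exact mul_lt_of_lt_one_right (by positivity) (by linarith)
    exact_mod_cast this
  -- The term m = i already moves the cumulative sum past the dyadic interval of word i, so
  -- truncating word j to ℓ i digits cannot return word i.
  have hstep : ∀ i j, i < j → a i + 1 ≤ a j / 2 ^ (ℓ j - ℓ i) := by
    intro i j hij
    rw [Nat.le_div_iff_mul_le (by positivity)]
    have hsub : ∑ m ∈ Finset.range (i + 1), 2 ^ (ℓ j - ℓ m) ≤ a j :=
      Finset.sum_le_sum_of_subset (Finset.range_subset_range.2 hij)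
    refine le_trans (le_of_eq ?_) hsub
    rw [Finset.sum_range_succ, add_mul, one_mul, ha, Finset.sum_mul]
    congr 1
    refine Finset.sum_congr rfl fun m hm => ?_
    rw [← pow_add]
    congr 1
    have h1 := hmono (Finset.mem_range.1 hm).le
    have h2 := hmono hij.le
    omega
  have hlen : ∀ i, (binaryWord (ℓ i) (a i)).length = ℓ i := fun i => length_binaryWord _ _
  have hno : ∀ i j, i < j → ¬ binaryWord (ℓ i) (a i) <+: binaryWord (ℓ j) (a j) := by
    intro i j hij h
    have hd : ℓ j = ℓ i + (ℓ j - ℓ i) := by have := hmono hij.le; omega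
    have := hstep i j hij
    have heq : a j / 2 ^ (ℓ j - ℓ i) = a i := by
      refine div_eq_of_binaryWord_prefix (hlt i) ?_ ?_
      · rw [← hd]; exact hlt j
      · rw [← hd]; exact h
    omega
  refine ⟨fun i => binaryWord (ℓ i) (a i), hlen, fun i j h => ?_⟩
  rcases lt_trichotomy i j with hij | hij | hij
  · exact absurd h (hno i j hij)
  · exact hij
  · have hle := h.length_le
    rw [hlen, hlen] at hle
    have heq := h.eq_of_length (by rw [hlen, hlen]; exact le_antisymm hle (hmono hij.le))
    simp only at heq
    exact absurd (heq ▸ List.prefix_rfl) (hno j i hij)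

lemma sum_range_rpow_neg_le {ε : ℝ} (hε : 0 < ε) (n : ℕ) :
    ∑ i ∈ Finset.range n, ((i : ℝ) + 1) ^ (-(1 + ε)) ≤ 1 + 1 / ε := by
  cases n with
  | zero => simp; positivity
  | succ n =>
    have hanti : AntitoneOn (fun x : ℝ => x ^ (-(1 + ε))) (Set.Icc (1 : ℝ) (1 + n)) :=
      fun x hx y _ hxy => Real.rpow_le_rpow_of_nonpos (by linarith [hx.1]) hxy (by linarith)
    have h := hanti.sum_le_integral
    have hint : ∫ x in (1 : ℝ)..(1 + n), x ^ (-(1 + ε)) = (1 - (1 + (n : ℝ)) ^ (-ε)) / ε := by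
      rw [integral_rpow]
      · rw [show -(1 + ε) + 1 = -ε by ring, Real.one_rpow]
        field_simp
        ring
      · right
        refine ⟨by linarith, fun h0 => ?_⟩
        rw [Set.uIcc_of_le (by simp)] at h0
        linarith [h0.1]
    rw [hint] at h
    rw [Finset.sum_range_succ']
    have hpos : 0 < (1 + (n : ℝ)) ^ (-ε) := by positivity
    have hle : (1 - (1 + (n : ℝ)) ^ (-ε)) / ε ≤ 1 / ε := by gcongr; linarith
    have hsum : ∑ i ∈ Finset.range n, (((i + 1 : ℕ) : ℝ) + 1) ^ (-(1 + ε)) =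
        ∑ i ∈ Finset.range n, (1 + ((i + 1 : ℕ) : ℝ)) ^ (-(1 + ε)) :=
      Finset.sum_congr rfl fun i _ => by rw [add_comm]
    rw [hsum]
    simp only [Nat.cast_zero, zero_add, Real.one_rpow]
    linarith

/-- A code on the positive integers whose codeword lengths are adapted to a power law. -/
lemma exists_uniquelyDecodable_code {ε : ℝ} (hε : 0 < ε) :
    ∃ C : ℕ+ → List Bool, IsUniquelyDecodableCode C ∧
      ∀ n : ℕ, ((C n.succPNat).length : ℝ) ≤
        (1 + ε) * Real.logb 2 (n + 1) + Real.logb 2 (1 + 1 / ε) + 1 := by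
  have hpow : 1 < 1 + 1 / ε := by simpa using hε
  have hlog : 0 < Real.logb 2 (1 + 1 / ε) := Real.logb_pos one_lt_two hpow
  -- The constant normalizes the Kraft sum, and its positivity makes every codeword nonempty,
  -- including the one for index 1. Rounding up costs the extra 1.
  set g : ℕ → ℝ := fun n => (1 + ε) * Real.logb 2 (n + 1) + Real.logb 2 (1 + 1 / ε) with hg
  have hg0 : ∀ n, 0 < g n := fun n => by
    have : 0 ≤ Real.logb 2 ((n : ℝ) + 1) := Real.logb_nonneg one_lt_two (by simp)
    positivity
  set ℓ : ℕ → ℕ := fun n => ⌈g n⌉₊ with hℓ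
  have hmono : Monotone ℓ := fun m n hmn => by
    refine Nat.ceil_mono ?_
    simp only [hg]
    gcongr
    exact one_lt_two
  have hterm : ∀ n, ((2 : ℝ) ^ ℓ n)⁻¹ ≤ ((n : ℝ) + 1) ^ (-(1 + ε)) * (1 + 1 / ε)⁻¹ := by
    intro n
    have h1 : (2 : ℝ) ^ g n ≤ (2 : ℝ) ^ ℓ n := by
      rw [← Real.rpow_natCast]
      exact Real.rpow_le_rpow_of_exponent_le one_le_two (Nat.le_ceil _)
    have h2 : (2 : ℝ) ^ g n = ((n : ℝ) + 1) ^ (1 + ε) * (1 + 1 / ε) := by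
      rw [hg]
      simp only
      rw [Real.rpow_add two_pos, mul_comm (1 + ε), Real.rpow_mul zero_le_two,
        Real.rpow_logb two_pos (by norm_num) (by positivity),
        Real.rpow_logb two_pos (by norm_num) (by positivity)]
    rw [Real.rpow_neg (by positivity), ← mul_inv, ← h2]
    gcongr
  have hkraft : ∀ n, ∑ i ∈ Finset.range n, ((2 : ℝ) ^ ℓ i)⁻¹ ≤ 1 := by
    intro n
    refine (Finset.sum_le_sum fun i _ => hterm i).trans ?_
    rw [← Finset.sum_mul]
    have := sum_range_rpow_neg_le hε n
    rw [← div_eq_mul_inv, div_le_one (by positivity)]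
    exact this
  obtain ⟨C, hlen, hpre⟩ := exists_prefix_free_code hmono hkraft
  refine ⟨fun k => C k.natPred, ⟨fun i j h => ?_, ?_⟩, fun n => ?_⟩
  · exact PNat.natPred_injective (hpre _ _ ((show C i.natPred = C j.natPred from h) ▸ List.prefix_rfl))
  · refine InformationTheory.uniquelyDecodable_of_prefix_free ?_ ?_
    · rintro ⟨k, hk⟩
      have h1 := hlen k.natPred
      simp only at hk
      rw [hk, List.length_nil] at h1
      have := Nat.ceil_pos.2 (hg0 k.natPred)
      simp only [hℓ] at h1
      omega
    · rintro _ ⟨i, rfl⟩ _ ⟨j, rfl⟩ h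
      exact congrArg C (hpre _ _ h)
  · simp only [Nat.natPred_succPNat, hlen]
    exact (Nat.ceil_lt_add_one (hg0 n).le).le

/-! ### Campbell cost and the constant -/

lemma log2_mono : Monotone log2 := fun _ _ h =>
  EReal.div_le_div_right_of_nonneg (by exact_mod_cast (Real.log_pos one_lt_two).le)
    (ENNReal.log_monotone h)

lemma log2_ofReal {x : ℝ} (hx : 0 < x) : log2 (ENNReal.ofReal x) = ((Real.logb 2 x : ℝ) : EReal) := by
  rw [log2, ENNReal.log_ofReal_of_pos hx, Real.logb, EReal.coe_div]

lemma log2_top : log2 ∞ = ⊤ := by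
  rw [log2, ENNReal.log_top, EReal.top_div_of_pos_ne_top
    (by exact_mod_cast Real.log_pos one_lt_two) (EReal.coe_ne_top _)]

lemma IsPoissonSetup.ae_existsUnique_and_minimizerEvent {Ω 𝓤 : Type*} [MeasurableSpace Ω]
    [MeasurableSpace 𝓤] {T : ℕ+ → Ω → ℝ} {U : ℕ+ → Ω → 𝓤} {P Q : Measure 𝓤}
    [IsProbabilityMeasure P] [IsProbabilityMeasure Q] (hPQ : P ≪ Q) {μ : Measure Ω}
    [IsProbabilityMeasure μ] (h : IsPoissonSetup T U Q μ) :
    (∀ᵐ ω ∂μ, ∃! k, IsPFRMinimizer P Q T U ω k) ∧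
    ∀ n : ℕ, μ {ω | pfrIndex P Q T U ω = n.succPNat} ≤
      (expSeq.prod (Measure.infinitePi fun _ : ℕ => Q)) (minimizerEvent (P.rnDeriv Q) n) := by
  obtain ⟨X, hX, hT, hU, hlaw⟩ := h.exists_interarrival
  have hf := Measure.measurable_rnDeriv P Q
  have h1 : ∫⁻ v, P.rnDeriv Q v ∂Q = 1 := by
    rw [Measure.lintegral_rnDeriv hPQ, measure_univ]
  have hae := ae_existsUnique_minimizer hf h1
  rw [← hlaw] at hae
  have hmin : ∀ ω k, IsPFRMinimizer P Q T U ω k ↔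
      ∀ i, ENNReal.ofReal (partialSum (X ω).1 k.natPred) / P.rnDeriv Q ((X ω).2 k.natPred) ≤
        ENNReal.ofReal (partialSum (X ω).1 i) / P.rnDeriv Q ((X ω).2 i) := by
    intro ω k
    simp only [← hT, ← hU, PNat.succPNat_natPred]
    exact ⟨fun h i => h _, fun h i => by
      have := h i.natPred
      rwa [PNat.succPNat_natPred] at this⟩
  have hae' : ∀ᵐ ω ∂μ, (∃! k, IsPFRMinimizer P Q T U ω k) ∧
      ∀ k, IsPFRMinimizer P Q T U ω k → X ω ∈ minimizerEvent (P.rnDeriv Q) k.natPred := by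
    filter_upwards [ae_of_ae_map hX.aemeasurable hae] with ω hω
    refine ⟨?_, fun k hk => hω.2 _ ((hmin ω k).1 hk)⟩
    obtain ⟨k, hk, huniq⟩ := hω.1
    refine ⟨k.succPNat, (hmin ω _).2 (by simpa using hk), fun k' hk' => ?_⟩
    have := huniq _ ((hmin ω k').1 hk')
    rw [← this, PNat.succPNat_natPred]
  refine ⟨hae'.mono fun ω hω => hω.1, fun n => ?_⟩
  rw [← hlaw]
  -- This direction of the pushforward comparison holds for arbitrary sets, so measurability of
  -- `minimizerEvent` is not needed.
  refine le_trans ?_ (Measure.le_map_apply hX.aemeasurable _)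
  refine measure_mono_ae ?_
  filter_upwards [hae'] with ω hω hK
  have hK' : pfrIndex P Q T U ω = n.succPNat := hK
  have hex : ∃ k, IsPFRMinimizer P Q T U ω k := hω.1.exists
  rw [pfrIndex, dif_pos hex] at hK'
  classical
  have hspec : IsPFRMinimizer P Q T U ω n.succPNat := by
    rw [← hK']
    exact PNat.find_spec hex
  have hmem := hω.2 _ hspec
  rw [Nat.natPred_succPNat] at hmem
  exact hmem

/-- The factor relating `E[f (1 + f) ^ r]` to `E[f ^ (1 + r)]` for a density `f`. -/
noncomputable def densityConst (r : ℝ) : ℝ := if r < 1 then Real.exp r else 2 ^ (3 * r - 2)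

lemma densityConst_pos (r : ℝ) : 0 < densityConst r := by
  unfold densityConst
  split_ifs <;> positivity

/-- The sharper factors 1 + r and 2^r are relaxed to e^r and 2^(3r-2), the latter using r ≥ 1, so
that the final constant is exactly `c₁`. -/
lemma lintegral_mul_one_add_rpow_le_densityConst {𝓤 : Type*} [MeasurableSpace 𝓤] {Q : Measure 𝓤}
    [IsProbabilityMeasure Q] {f : 𝓤 → ℝ≥0∞} (hf : Measurable f) (h1 : ∫⁻ v, f v ∂Q = 1) {r : ℝ}
    (hr : 0 < r) :
    ∫⁻ v, f v * (1 + f v) ^ r ∂Q ≤ ENNReal.ofReal (densityConst r) * ∫⁻ v, f v ^ (1 + r) ∂Q := by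
  unfold densityConst
  split_ifs with h
  · refine (lintegral_mul_one_add_rpow_le hf h1 hr h.le).trans ?_
    gcongr
    linarith [Real.add_one_le_exp r]
  · refine (lintegral_mul_one_add_rpow_le_two_rpow hf h1 (not_lt.1 h)).trans ?_
    gcongr
    rw [show (2 : ℝ≥0∞) = ENNReal.ofReal 2 by simp, ENNReal.ofReal_rpow_of_pos two_pos]
    refine ENNReal.ofReal_le_ofReal (Real.rpow_le_rpow_of_exponent_le one_le_two ?_)
    linarith

lemma tsum_campbell_le {Ω 𝓤 : Type*} [MeasurableSpace Ω] [MeasurableSpace 𝓤] {T : ℕ+ → Ω → ℝ}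
    {U : ℕ+ → Ω → 𝓤} {P Q : Measure 𝓤} [IsProbabilityMeasure P] [IsProbabilityMeasure Q]
    (hPQ : P ≪ Q) {μ : Measure Ω} [IsProbabilityMeasure μ] (h : IsPoissonSetup T U Q μ)
    {C : ℕ+ → List Bool} {t ε b : ℝ} (ht : 0 < t) (hε : 0 < ε)
    (hC : ∀ n : ℕ, ((C n.succPNat).length : ℝ) ≤ (1 + ε) * Real.logb 2 (n + 1) + b) :
    ∑' k : ℕ+, μ {ω | pfrIndex P Q T U ω = k} * (2 : ℝ≥0∞) ^ (t * ((C k).length : ℝ)) ≤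
      ENNReal.ofReal (2 ^ (t * b) * momentConst ((1 + ε) * t) * densityConst ((1 + ε) * t)) *
        ∫⁻ x, (P.rnDeriv Q x) ^ (1 + (1 + ε) * t) ∂Q := by
  set r := (1 + ε) * t with hr
  have hr0 : 0 < r := by positivity
  have hf := Measure.measurable_rnDeriv P Q
  have h1 : ∫⁻ v, P.rnDeriv Q v ∂Q = 1 := by
    rw [Measure.lintegral_rnDeriv hPQ, measure_univ]
  have hlen : ∀ n : ℕ, (2 : ℝ≥0∞) ^ (t * ((C n.succPNat).length : ℝ)) ≤
      ENNReal.ofReal (2 ^ (t * b)) * ENNReal.ofReal (((n : ℝ) + 1) ^ r) := by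
    intro n
    rw [show (2 : ℝ≥0∞) = ENNReal.ofReal 2 by simp, ENNReal.ofReal_rpow_of_pos two_pos,
      ← ENNReal.ofReal_mul (by positivity)]
    refine ENNReal.ofReal_le_ofReal ?_
    calc (2 : ℝ) ^ (t * ((C n.succPNat).length : ℝ))
        ≤ 2 ^ (t * ((1 + ε) * Real.logb 2 (n + 1) + b)) :=
          Real.rpow_le_rpow_of_exponent_le one_le_two (by gcongr; exact hC n)
      _ = 2 ^ (t * b + Real.logb 2 (n + 1) * r) := by rw [hr]; ring_nf
      _ = _ := by
          rw [Real.rpow_add two_pos, Real.rpow_mul zero_le_two (Real.logb 2 _),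
            Real.rpow_logb two_pos (by norm_num) (by positivity)]
  rw [← Equiv.pnatEquivNat.symm.tsum_eq]
  calc _ ≤ ∑' n : ℕ, ENNReal.ofReal (2 ^ (t * b)) * (ENNReal.ofReal (((n : ℝ) + 1) ^ r) *
        (expSeq.prod (Measure.infinitePi fun _ : ℕ => Q)) (minimizerEvent (P.rnDeriv Q) n)) := by
        refine ENNReal.tsum_le_tsum fun n => ?_
        rw [← mul_assoc, mul_comm]
        exact mul_le_mul' (hlen n) ((h.ae_existsUnique_and_minimizerEvent hPQ).2 n)
    _ ≤ ENNReal.ofReal (2 ^ (t * b)) * (ENNReal.ofReal (momentConst r) *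
        (ENNReal.ofReal (densityConst r) * ∫⁻ x, (P.rnDeriv Q x) ^ (1 + r) ∂Q)) := by
        rw [ENNReal.tsum_mul_left]
        gcongr
        refine (tsum_rpow_mul_measure_minimizerEvent_le hf h1 hr0).trans ?_
        gcongr
        exact lintegral_mul_one_add_rpow_le_densityConst hf h1 hr0
    _ = _ := by
        have := momentConst_pos hr0
        rw [ENNReal.ofReal_mul (by positivity), ENNReal.ofReal_mul (by positivity)]
        ring

/-- With t = (1 - α)/α and r = (1 + ε)t, the case distinction in `c₁` is r < 1. Dividing by t turns
e^r into (1 + ε) log e, and 2^(3r-2) into 3 + 3ε - 2/t. -/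
lemma c₁_eq {α ε : ℝ} (hα : 0 < α) (hα1 : α < 1) (hε : 0 < ε) :
    c₁ α ε = 1 / ((1 - α) / α) * Real.logb 2
      (2 ^ ((1 - α) / α * (Real.logb 2 (1 + 1 / ε) + 1)) *
        momentConst ((1 + ε) * ((1 - α) / α)) * densityConst ((1 + ε) * ((1 - α) / α))) := by
  have h1α : 0 < 1 - α := by linarith
  set t := (1 - α) / α with ht
  have ht0 : 0 < t := by positivity
  have hr0 : 0 < (1 + ε) * t := by positivity
  have hcond : (1 / 2 < α ∧ α < 1 ∧ 0 < ε ∧ ε < (2 * α - 1) / (1 - α)) ↔ (1 + ε) * t < 1 := by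
    rw [ht, ← mul_div_assoc, div_lt_one hα, lt_div_iff₀ h1α]
    constructor
    · rintro ⟨_, _, _, h⟩
      linarith
    · intro h
      have : 0 < ε * (1 - α) := by positivity
      exact ⟨by linarith, hα1, hε, by linarith⟩
  rw [Real.logb_mul (mul_pos (by positivity) (momentConst_pos hr0)).ne' (densityConst_pos _).ne',
    Real.logb_mul (by positivity) (momentConst_pos hr0).ne', Real.logb_rpow two_pos (by norm_num)]
  unfold c₁ momentConst densityConst
  simp only [hcond]
  split_ifs with h
  · rw [Real.logb_one, ← Real.exp_one_rpow ((1 + ε) * t),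
      Real.logb_rpow_eq_mul_logb_of_pos (Real.exp_pos 1)]
    field_simp
    ring
  · rw [Real.logb_rpow two_pos (by norm_num),
      show (1 + ε * (1 - α)) / α = 1 + (1 + ε) * t by rw [ht]; field_simp; ring,
      show α / (1 - α) = 1 / t by rw [ht, one_div_div],
      show 2 * α / (1 - α) = 2 / t by rw [ht]; field_simp]
    field_simp
    ring

theorem theorem2 {𝓤 : Type*} [TopologicalSpace 𝓤] [PolishSpace 𝓤] [MeasurableSpace 𝓤]
    [BorelSpace 𝓤] (P Q : Measure 𝓤) [IsProbabilityMeasure P] [IsProbabilityMeasure Q]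
    (hPQ : P ≪ Q)
    {Ω : Type*} [MeasurableSpace Ω] (μ : Measure Ω) [IsProbabilityMeasure μ]
    (T : ℕ+ → Ω → ℝ) (U : ℕ+ → Ω → 𝓤) (hTU : IsPoissonSetup T U Q μ) :
    (∀ᵐ ω ∂μ, ∃! k, IsPFRMinimizer P Q T U ω k) ∧
    ∀ α ε : ℝ, 0 < α → α < 1 → 0 < ε →
      ∃ C : ℕ+ → List Bool, IsUniquelyDecodableCode C ∧
        campbellCost μ (pfrIndex P Q T U) C ((1 - α) / α) ≤
          ((1 + ε : ℝ) : EReal) * renyiDivergence ((1 + ε * (1 - α)) / α) P Q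
            + ((c₁ α ε : ℝ) : EReal) := by
  refine ⟨(hTU.ae_existsUnique_and_minimizerEvent hPQ).1, fun α ε hα hα1 hε => ?_⟩
  obtain ⟨C, hC, hlen⟩ := exists_uniquelyDecodable_code hε
  refine ⟨C, hC, ?_⟩
  have h1α : 0 < 1 - α := by linarith
  have ht : 0 < (1 - α) / α := by positivity
  have hsum := tsum_campbell_le hPQ hTU (C := C) (b := Real.logb 2 (1 + 1 / ε) + 1) ht hε
    (fun n => by linarith [hlen n])
  have hc := c₁_eq hα hα1 hε
  -- The Rényi order is 1 + r, so its prefactor is 1/r, and (1 + ε)/r = 1/t matches the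
  -- normalization of the Campbell cost.
  have hβ : (1 + ε * (1 - α)) / α = 1 + (1 + ε) * ((1 - α) / α) := by field_simp; ring
  rw [hβ]
  set t := (1 - α) / α
  set r := (1 + ε) * t with hr
  have hr0 : 0 < r := by positivity
  set κ : ℝ := 2 ^ (t * (Real.logb 2 (1 + 1 / ε) + 1)) * momentConst r * densityConst r
  have hκ : 0 < κ := by
    have := momentConst_pos hr0
    have := densityConst_pos r
    positivity
  set M := ∫⁻ x, (P.rnDeriv Q x) ^ (1 + r) ∂Q with hM
  have hM1 : 1 ≤ M := one_le_lintegral_rpow (Measure.measurable_rnDeriv P Q)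
    (by rw [Measure.lintegral_rnDeriv hPQ, measure_univ]) hr0
  have hr1 : 1 + r - 1 = r := by ring
  rw [renyiDivergence, ← hM, hr1]
  -- An infinite divergence makes the right side ⊤; otherwise M ≥ 1 is a positive real and the
  -- logarithms can be computed in ℝ.
  by_cases hMt : M = ∞
  · rw [hMt, log2_top, EReal.coe_mul_top_of_pos (by positivity),
      EReal.coe_mul_top_of_pos (by positivity), EReal.top_add_coe]
    exact le_top
  · have hm1 : 1 ≤ M.toReal := by simpa using ENNReal.toReal_mono hMt hM1
    have hm0 : 0 < M.toReal := by linarith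
    rw [← ENNReal.ofReal_toReal hMt, ← ENNReal.ofReal_mul hκ.le] at hsum
    have hlog := log2_mono hsum
    rw [log2_ofReal (by positivity)] at hlog
    rw [campbellCost, ← ENNReal.ofReal_toReal hMt, log2_ofReal hm0]
    refine (mul_le_mul_of_nonneg_left hlog (by exact_mod_cast (by positivity))).trans (le_of_eq ?_)
    rw [hc, ← EReal.coe_mul, ← EReal.coe_mul, ← EReal.coe_mul, ← EReal.coe_add,
      Real.logb_mul hκ.ne' hm0.ne', hr]
    congr 1
    field_simp
    ring
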